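/- **Theorem.** Let $\kappa,c>0$, $\beta_n=\frac{\kappa^2}{c^2}(n+1)$, and let $\gamma>0$ with $\gamma^2=\beta_0$. Let $\Omega\subset\mathbb R^2$ be a bounded domain whose boundary $\Gamma$ is $C^3$, that is, a disjoint union of finitely many simple closed regular $C^3$ curves, with outward unit normal $\nu$ and arc length $ds$. Let $I_0(z)=\sum_{n\ge0}\frac{(z/2)^{2n}}{(n!)^2}$ and $I_1(z)=\sum_{n\ge0}\frac{(z/2)^{2n+1}}{n!\,(n+1)!}$, and for $z>0$ $$K_0(z)=-\Big(\ln\frac z2+C\Big)I_0(z)+\sum_{n\ge1}\frac{\psi(n)}{(n!)^2}\Big(\frac z2\Big)^{2n},$$ $$K_1(z)=\frac1z+\Big(\ln\frac z2+C\Big)I_1(z)-\frac12\sum_{n\ge0}\frac{\psi(n+1)+\psi(n)}{n!\,(n+1)!}\Big(\frac z2\Big)^{2n+1},$$ where $\psi(0)=0$, $\psi(n)=\sum_{m=1}^n\frac1m$ and $C$ is Euler's constant. Define numbers $a_{n,k}$, $0\le k\le n$, by $$a_{n,0}=1,\qquad a_{n,n}=-\frac{\beta_1}{2\gamma n}\,a_{n-1,n-1}\quad(n\ge1),$$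 $$a_{n,k}=\frac1{2\gamma k}\Big\{4\Big[\frac{k+1}2\Big]^2a_{n,k+1}-\sum_{m=k-1}^{n-1}\beta_{n-m}a_{m,k-1}\Big\},\quad k=n-1,\dots,1,$$ set $v_n(r)=\sum_{0\le 2k\le n}a_{n,2k}r^{2k}$ and $w_n(r)=\sum_{1\le 2k+1\le n}a_{n,2k+1}r^{2k+1}$ (so $w_0=0$), and let $$\Phi_n(x,y)=K_0(\gamma|x-y|)\,v_n(|x-y|)+K_1(\gamma|x-y|)\,w_n(|x-y|),\qquad x\ne y.$$ For a density $q$ on $\Gamma$, let $T_nq$ be the normal derivative of the $n$-th double-layer operator, $$(T_nq)(x)=\frac1\pi\,\frac{\partial}{\partial\nu(x)}\int_\Gamma q(y)\,\frac{\partial\Phi_n(x,y)}{\partial\nu(y)}\,ds(y),\qquad x\in\Gamma,$$ where $\partial w/\partial\nu(x)$ is the limit of $\nu(x)\cdot\nabla w(x+h\nu(x))$ as $h\to0$, $h\ne0$. Let $0<\alpha<1$, let $f_0,f_1,\dots$ be functions on $\Gamma$, and let the densities $q_0,q_1,\dots\in C^{1,\alpha}(\Gamma)$ satisfy $$(T_0q_n)(x)=f_n(x)-\sum_{m=0}^{n-1}(T_{n-m}q_m)(x),\qquad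 x\in\Gamma,\quad n=0,1,\dots$$ Then the functions $$u_n(x)=\frac1\pi\sum_{m=0}^n\int_\Gamma q_m(y)\,\frac{\partial\Phi_{n-m}(x,y)}{\partial\nu(y)}\,ds(y),\qquad x\in\Omega,$$ solve the sequence of Neumann problems $$\Delta u_n-\gamma^2u_n=\sum_{m=0}^{n-1}\beta_{n-m}u_m\ \text{ in }\Omega,\qquad \frac{\partial u_n}{\partial\nu}=f_n\ \text{ on }\Gamma,\qquad n=0,1,\dots,$$ in the classical sense: for every $n$, $u_n\in C^2(\Omega)$, $u_n$ extends continuously to $\overline\Omega$, the differential equation holds at every point of $\Omega$, and for every $x\in\Gamma$ the limit $\lim_{h\to0+}\nu(x)\cdot\nabla u_n(x-h\nu(x))$ exists and equals $f_n(x)$. -/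

import Mathlib

open Set Filter Topology
open scoped NNReal

noncomputable section

namespace LaguerreNeumann

/-- The Euclidean plane. -/
abbrev Plane : Type := EuclideanSpace ℝ (Fin 2)

/-! ### The coefficients of the elliptic system -/

/-- `β_n = (κ² / c²) (n + 1)`. -/
def beta (κ c : ℝ) (n : ℕ) : ℝ := κ ^ 2 / c ^ 2 * ((n : ℝ) + 1)

/-- `γ > 0` with `γ² = β_0`. -/
def gam (κ c : ℝ) : ℝ := Real.sqrt (beta κ c 0)

/-! ### Modified Bessel and Hankel functions of orders zero and one -/

/-- Modified Bessel function `I_0`. -/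
def besselI0 (z : ℝ) : ℝ :=
  ∑' n : ℕ, 1 / ((n.factorial : ℝ) ^ 2) * (z / 2) ^ (2 * n)

/-- Modified Bessel function `I_1`. -/
def besselI1 (z : ℝ) : ℝ :=
  ∑' n : ℕ, 1 / ((n.factorial : ℝ) * ((n + 1).factorial : ℝ)) * (z / 2) ^ (2 * n + 1)

/-- `ψ(n) = ∑_{m=1}^n 1/m`, with `ψ(0) = 0`. -/
def psi (n : ℕ) : ℝ := ∑ m ∈ Finset.Icc 1 n, 1 / (m : ℝ)

/-- Modified Hankel (Macdonald) function `K_0` (used for `z > 0`). The term `n = 0` of the series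
is zero. -/
def besselK0 (z : ℝ) : ℝ :=
  -(Real.log (z / 2) + Real.eulerMascheroniConstant) * besselI0 z
    + ∑' n : ℕ, psi n / ((n.factorial : ℝ) ^ 2) * (z / 2) ^ (2 * n)

/-- Modified Hankel (Macdonald) function `K_1` (used for `z > 0`). -/
def besselK1 (z : ℝ) : ℝ :=
  1 / z + (Real.log (z / 2) + Real.eulerMascheroniConstant) * besselI1 z
    - 1 / 2 * ∑' n : ℕ, (psi (n + 1) + psi n) / ((n.factorial : ℝ) * ((n + 1).factorial : ℝ))
        * (z / 2) ^ (2 * n + 1)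

/-! ### The fundamental sequence -/

/-- The triangular array `a_{n,k}`, `0 ≤ k ≤ n` (it is set to `0` for `k > n`). The division
`(k + 1) / 2` is that of natural numbers, so it is the integer part. -/
def coeffA (κ c : ℝ) (n k : ℕ) : ℝ :=
  if k = 0 then 1
  else if n < k then 0
  else if k = n then
    if hn : 0 < n then
      -(1 / (2 * gam κ c * (n : ℝ))) * beta κ c 1 * coeffA κ c (n - 1) (n - 1)
    else 0
  else
    if hk : k < n then
      1 / (2 * gam κ c * (k : ℝ)) *
        (4 * (((k + 1) / 2 : ℕ) : ℝ) ^ 2 * coeffA κ c n (k + 1)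
          - ∑ m : Fin n, if k - 1 ≤ (m : ℕ) then
              beta κ c (n - (m : ℕ)) * coeffA κ c (m : ℕ) (k - 1) else 0)
    else 0
termination_by (n, n - k)
decreasing_by
  · exact Prod.Lex.left _ _ (by omega)
  · exact Prod.Lex.right _ (by omega)
  · exact Prod.Lex.left _ _ m.isLt

/-- `a_{n,0} = 1`. -/
theorem coeffA_zero (κ c : ℝ) (n : ℕ) : coeffA κ c n 0 = 1 := by
  rw [coeffA]; simp

/-- `a_{n,n} = -(1 / (2 γ n)) β_1 a_{n-1,n-1}` for `n ≥ 1`. -/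
theorem coeffA_diag (κ c : ℝ) (n : ℕ) (hn : 1 ≤ n) :
    coeffA κ c n n =
      -(1 / (2 * gam κ c * (n : ℝ))) * beta κ c 1 * coeffA κ c (n - 1) (n - 1) := by
  rw [coeffA, if_neg (by omega), if_neg (by omega), if_pos rfl, dif_pos (by omega)]

/-- The recursion for `a_{n,k}`, `1 ≤ k ≤ n - 1`. -/
theorem coeffA_rec (κ c : ℝ) (n k : ℕ) (hk : 1 ≤ k) (hkn : k < n) :
    coeffA κ c n k = 1 / (2 * gam κ c * (k : ℝ)) *
      (4 * (((k + 1) / 2 : ℕ) : ℝ) ^ 2 * coeffA κ c n (k + 1)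
        - ∑ m ∈ Finset.Icc (k - 1) (n - 1),
            beta κ c (n - m) * coeffA κ c m (k - 1)) := by
  rw [coeffA, if_neg (by omega), if_neg (by omega), if_neg (by omega), dif_pos hkn]
  congr 2
  rw [Fin.sum_univ_eq_sum_range
    (fun m => if k - 1 ≤ m then beta κ c (n - m) * coeffA κ c m (k - 1) else 0) n,
    ← Finset.sum_filter]
  refine Finset.sum_congr ?_ fun _ _ => rfl
  ext m
  simp only [Finset.mem_filter, Finset.mem_range, Finset.mem_Icc]
  omega

/-- `v_n(r) = ∑_{k=0}^{[n/2]} a_{n,2k} r^{2k}`. -/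
def polyV (κ c : ℝ) (n : ℕ) (r : ℝ) : ℝ :=
  ∑ k ∈ Finset.range (n / 2 + 1), coeffA κ c n (2 * k) * r ^ (2 * k)

/-- `w_n(r) = ∑_{k=0}^{[(n-1)/2]} a_{n,2k+1} r^{2k+1}`, and `w_0 = 0`; there are
`[(n-1)/2] + 1 = [(n+1)/2]` terms. -/
def polyW (κ c : ℝ) (n : ℕ) (r : ℝ) : ℝ :=
  ∑ k ∈ Finset.range ((n + 1) / 2), coeffA κ c n (2 * k + 1) * r ^ (2 * k + 1)

/-- The radial profile `Φ_n(r) = K_0(γ r) v_n(r) + K_1(γ r) w_n(r)`. -/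
def fundProfile (κ c : ℝ) (n : ℕ) (r : ℝ) : ℝ :=
  besselK0 (gam κ c * r) * polyV κ c n r + besselK1 (gam κ c * r) * polyW κ c n r

/-- The fundamental sequence `Φ_n(x, y) = Φ_n(|x - y|)`. -/
def fundSol (κ c : ℝ) (n : ℕ) (x y : Plane) : ℝ := fundProfile κ c n ‖x - y‖

/-! ### Bounded domains with `C³` boundary -/

/-- The unit normal to the curve `z` at `z s`: the unit tangent turned clockwise by a right
angle, `(z₂', -z₁') / |z'|`. -/
def normal (z : ℝ → Plane) (s : ℝ) : Plane :=
  ‖deriv z s‖⁻¹ • !₂[deriv z s 1, -(deriv z s 0)]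

/-- `Ω` is a bounded domain in the plane with `C³` boundary `Γ = ∂Ω`: the boundary is the disjoint
union of finitely many simple closed regular `C³` curves, with `2π`-periodic parametrizations
`z 0, …, z (k - 1)`, each oriented such that `normal` is the outward normal (so that `Ω` lies to
the left of each curve). -/
structure IsC3Domain {k : ℕ} (Ω : Set Plane) (z : Fin k → ℝ → Plane) : Prop where
  isOpen : IsOpen Ω
  isConnected : IsConnected Ω
  isBounded : Bornology.IsBounded Ω
  contDiff : ∀ j, ContDiff ℝ 3 (z j)
  periodic : ∀ j, Function.Periodic (z j) (2 * Real.pi)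
  regular : ∀ j s, deriv (z j) s ≠ 0
  injective : ∀ i j, ∀ s ∈ Ico 0 (2 * Real.pi), ∀ t ∈ Ico 0 (2 * Real.pi),
    z i s = z j t → i = j ∧ s = t
  frontier_eq : frontier Ω = ⋃ j, range (z j)
  inward : ∀ j s, ∀ᶠ h in 𝓝[>] (0 : ℝ), z j s - h • normal (z j) s ∈ Ω
  outward : ∀ j s, ∀ᶠ h in 𝓝[>] (0 : ℝ), z j s + h • normal (z j) s ∉ Ω

/-- The line integral `∫_Γ g ds` over `Γ`; the integrand is given as a function of the index of
the boundary curve and of the parameter. -/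
def boundaryIntegral {k : ℕ} (z : Fin k → ℝ → Plane) (g : Fin k → ℝ → ℝ) : ℝ :=
  ∑ j, ∫ σ in (0 : ℝ)..(2 * Real.pi), g j σ * ‖deriv (z j) σ‖

/-- `q ∈ C^{1,α}(Γ)`: along each boundary curve `q` is continuously differentiable with Hölder
continuous derivative. Only the values of `q` on `Γ` matter. -/
def IsC1Holder {k : ℕ} (α : ℝ≥0) (z : Fin k → ℝ → Plane) (q : Plane → ℝ) : Prop :=
  ∀ j, ContDiff ℝ 1 (fun s => q (z j s)) ∧
    ∃ C : ℝ≥0, HolderWith C α (deriv fun s => q (z j s))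

/-! ### Double-layer potentials -/

/-- `∫_Γ q(y) ∂Φ_n(x, y)/∂ν(y) ds(y)`. -/
def doubleLayerIntegral (κ c : ℝ) {k : ℕ} (z : Fin k → ℝ → Plane) (n : ℕ) (q : Plane → ℝ)
    (x : Plane) : ℝ :=
  boundaryIntegral z fun j σ =>
    q (z j σ) * fderiv ℝ (fun y => fundSol κ c n x y) (z j σ) (normal (z j) σ)

/-- The double-layer ansatz
`u_n(x) = (1/π) ∑_{m=0}^n ∫_Γ q_m(y) ∂Φ_{n-m}(x, y)/∂ν(y) ds(y)`. -/
def doubleLayerAnsatz (κ c : ℝ) {k : ℕ} (z : Fin k → ℝ → Plane) (q : ℕ → Plane → ℝ) (n : ℕ)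
    (x : Plane) : ℝ :=
  1 / Real.pi * ∑ m ∈ Finset.range (n + 1), doubleLayerIntegral κ c z (n - m) (q m) x

/-- The normal derivative on `Γ`, at the point `z j s`, of a function `u` given off `Γ`: the
(two-sided) limit of `ν · ∇u` along the normal line through that point. -/
def normalDerivative {k : ℕ} (z : Fin k → ℝ → Plane) (u : Plane → ℝ) (j : Fin k) (s : ℝ) : ℝ :=
  limUnder (𝓝[≠] (0 : ℝ)) fun h =>
    fderiv ℝ u (z j s + h • normal (z j) s) (normal (z j) s)

/-- The hypersingular operator `T_n`, the normal derivative on `Γ` of the `n`-th double-layer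
potential: `(T_n q)(x) = (1/π) ∂/∂ν(x) ∫_Γ q(y) ∂Φ_n(x, y)/∂ν(y) ds(y)` at `x = z j s`. -/
def opT (κ c : ℝ) {k : ℕ} (z : Fin k → ℝ → Plane) (n : ℕ) (q : Plane → ℝ) (j : Fin k) (s : ℝ) :
    ℝ :=
  1 / Real.pi * normalDerivative z (doubleLayerIntegral κ c z n q) j s

/-! ### The sequence of Neumann problems -/

/-- `u_0, u_1, …` is a classical solution of the sequence of Neumann problems
`Δu_n - γ² u_n = ∑_{m<n} β_{n-m} u_m` in `Ω`, `∂u_n/∂ν = f_n` on `Γ`: each `u_n` is in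
`C²(Ω)` and has a continuous extension to the closure of `Ω`, the differential equations hold in
`Ω`, and the normal derivatives exist as limits from inside `Ω` along the normal, with the
prescribed values. -/
structure SolvesNeumann (κ c : ℝ) {k : ℕ} (Ω : Set Plane) (z : Fin k → ℝ → Plane)
    (f u : ℕ → Plane → ℝ) : Prop where
  contDiffOn : ∀ n, ContDiffOn ℝ 2 (u n) Ω
  extends_closure : ∀ n, ∃ g : Plane → ℝ, ContinuousOn g (closure Ω) ∧ EqOn g (u n) Ω
  equation : ∀ n, ∀ x ∈ Ω,
    Laplacian.laplacian (u n) x - gam κ c ^ 2 * u n x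
      = ∑ m ∈ Finset.range n, beta κ c (n - m) * u m x
  boundary : ∀ n j s,
    Tendsto (fun h : ℝ => fderiv ℝ (u n) (z j s - h • normal (z j) s) (normal (z j) s))
      (𝓝[>] 0) (𝓝 (f n (z j s)))

end LaguerreNeumann

end

/-!
The proof treats everything in the variable `ρ = |x - y|²`. In this variable the fundamental
sequence has profiles `g(ρ) = P(ρ) (log ρ) / 2 + Q(ρ)` with smooth `P`, `Q` and `P(0) = -1`
(`isLogProfile_profile`), so that `g' = -1 / (2ρ) + …` and `g'' = 1 / (2ρ²) + …`, where the dots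
are singularities that are integrable along curves (`IsLogProfile.bounds`).

*The differential equation.* The relations `K₀' = -K₁`, `(z K₁)' = -z K₀` and the recursion for
`a_{n,k}` give `4 (ρ g_n')' = γ² g_n + ∑_{m<n} β_{n-m} g_m`
(`hasDerivAt_id_mul_deriv_profile`). Differentiated once more, this is the equation for the kernel
of the double-layer potential, and away from the boundary differentiation passes under the
integral (`laplacian_layer`, `laplacian_dlp_profile`).

*The normal derivative.* With `p = x - z(s)`, the kernel `∂_e ∂_N log |p|` is the derivative along
the curve of `⟪p, e'⟫ / |p|²`, where `e'` is `e` rotated by a right angle, so one integration by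
parts turns the logarithmic part of the gradient into `-∫ w' ⟪p, e'⟫ / |p|² ds`
(`IsLogProfile.fderiv_dlp_eq`). For `e` the normal at `z(s₀)`, `e'` is the unit tangent `τ`. Since
`∫ ⟪p, z'⟫ / |p|² ds = 0` on a closed curve, the multiple `w'(s₀) / |z'(s₀)|` of `z'` may be
subtracted from `w' τ`; the difference is `O(|s - s₀|^α)`, and since `|p| ≥ a |s - s₀|` on the
normal line, dominated convergence gives the limit from both sides
(`IsClosedCurve.exists_tendsto_log_part`, `IsLogProfile.exists_tendsto_normal`). Hence the
operators `T_n` are genuine limits, and the boundary condition is the given system of integral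
equations.

*Continuity up to the boundary.* The same formula shows that the potential of a constant density
for the logarithmic kernel has zero gradient, hence is constant on `Ω` (`dlp_log_one_const`).
After subtraction of the value of the density at the point of the curve nearest to `x`, the
integrand is bounded, and dominated convergence applies
(`IsLogProfile.exists_tendsto_boundary`).
-/

noncomputable section

namespace LaguerreNeumann

open scoped ContDiff RealInnerProductSpace

/-! ### Power series with factorially small coefficients -/

/-- The sum of the power series with coefficients `a`. -/
def expSeries (a : ℕ → ℝ) (t : ℝ) : ℝ := ∑' n, a n * t ^ n

/-- Coefficients of exponential type: `|a n| ≤ M / n!` for some `M`. This class is closed under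
termwise differentiation and makes the power series converge everywhere. -/
def IsExpType (a : ℕ → ℝ) : Prop := ∃ M, ∀ n, |a n| ≤ M / (n.factorial : ℝ)

/-- Coefficients of the derivative of the power series with coefficients `a`. -/
def shiftCoeff (a : ℕ → ℝ) (n : ℕ) : ℝ := (n + 1) * a (n + 1)

theorem IsExpType.shift {a : ℕ → ℝ} (ha : IsExpType a) : IsExpType (shiftCoeff a) := by
  obtain ⟨M, hM⟩ := ha
  refine ⟨M, fun n => ?_⟩
  have h := hM (n + 1)
  have hn : (0 : ℝ) < n + 1 := by positivity
  have hf : (0 : ℝ) < n.factorial := by positivity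
  rw [shiftCoeff, abs_mul, abs_of_pos hn]
  rw [Nat.factorial_succ, Nat.cast_mul, le_div_iff₀ (by positivity)] at h
  rw [le_div_iff₀ hf]
  push_cast at h
  linarith

theorem IsExpType.summable_bound {a : ℕ → ℝ} (ha : IsExpType a) (R : ℝ) :
    Summable fun n => |a n| * |R| ^ n := by
  obtain ⟨M, hM⟩ := ha
  refine Summable.of_nonneg_of_le (fun n => by positivity) (fun n => ?_)
    ((Real.summable_pow_div_factorial |R|).mul_left M)
  have := mul_le_mul_of_nonneg_right (hM n) (pow_nonneg (abs_nonneg R) n)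
  calc _ ≤ _ := this
    _ = _ := by ring

theorem IsExpType.summable {a : ℕ → ℝ} (ha : IsExpType a) (t : ℝ) :
    Summable fun n => a n * t ^ n :=
  Summable.of_norm (by simpa [abs_mul] using ha.summable_bound t)

theorem IsExpType.hasDerivAt {a : ℕ → ℝ} (ha : IsExpType a) (t : ℝ) :
    HasDerivAt (expSeries a) (expSeries (shiftCoeff a) t) t := by
  have hR : |t| ≤ |t| + 1 := by linarith
  have hsum := ha.shift.summable_bound (|t| + 1)
  have hsum' : Summable fun n : ℕ => |a n| * n * (|t| + 1) ^ (n - 1) := by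
    rw [← summable_nat_add_iff 1]
    refine hsum.congr fun n => ?_
    rw [shiftCoeff, abs_mul, abs_of_nonneg (by positivity : (0 : ℝ) ≤ n + 1),
      abs_of_nonneg (by positivity : 0 ≤ |t| + 1)]
    push_cast
    ring
  have key := hasDerivAt_tsum_of_isPreconnected (𝕜 := ℝ)
    (g := fun n (y : ℝ) => a n * y ^ n)
    (g' := fun n (y : ℝ) => a n * (n * y ^ (n - 1))) (t := Metric.ball (0 : ℝ) (|t| + 1))
    (y₀ := 0) (y := t) hsum' Metric.isOpen_ball
    (convex_ball (0 : ℝ) _).isPreconnected (fun n y _ => (hasDerivAt_pow n y).const_mul _)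
    (fun n y hy => by
      rw [mem_ball_zero_iff, Real.norm_eq_abs] at hy
      rw [norm_mul, norm_mul, norm_pow, Real.norm_eq_abs, Real.norm_eq_abs, Real.norm_eq_abs,
        Nat.abs_cast, mul_assoc]
      gcongr)
    (Metric.mem_ball_self (by positivity)) (ha.summable 0) (by simp)
  suffices expSeries (shiftCoeff a) t = ∑' n, a n * (n * t ^ (n - 1)) by
    rw [this]
    exact key
  rw [expSeries]
  have hs : Summable fun n : ℕ => a n * (n * t ^ (n - 1)) := by
    refine Summable.of_norm_bounded hsum' fun n => ?_
    rw [norm_mul, norm_mul, norm_pow, Real.norm_eq_abs, Real.norm_eq_abs, Real.norm_eq_abs,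
        Nat.abs_cast, mul_assoc]
    gcongr
  rw [hs.tsum_eq_zero_add]
  simp only [Nat.cast_zero, zero_mul, mul_zero, zero_add]
  refine tsum_congr fun n => ?_
  rw [shiftCoeff]
  push_cast
  ring

theorem IsExpType.contDiff {a : ℕ → ℝ} (ha : IsExpType a) (n : ℕ) :
    ContDiff ℝ n (expSeries a) := by
  induction n generalizing a with
  | zero =>
    exact contDiff_zero.2 (continuous_iff_continuousAt.2 fun t => (ha.hasDerivAt t).continuousAt)
  | succ n ih =>
    push_cast
    refine contDiff_succ_iff_deriv.2 ⟨fun t => (ha.hasDerivAt t).differentiableAt, by simp, ?_⟩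
    rw [show deriv (expSeries a) = expSeries (shiftCoeff a) from
      funext fun t => (ha.hasDerivAt t).deriv]
    exact ih ha.shift

/-- `t f'(t) = ∑ n aₙ tⁿ`. -/
theorem IsExpType.hasSum_mul_deriv {a : ℕ → ℝ} (ha : IsExpType a) (t : ℝ) :
    HasSum (fun n : ℕ => n * a n * t ^ n) (t * expSeries (shiftCoeff a) t) := by
  have h := (ha.shift.summable t).hasSum.mul_left t
  have h2 : HasSum (fun n : ℕ => ((n + 1 : ℕ) : ℝ) * a (n + 1) * t ^ (n + 1))
      (t * expSeries (shiftCoeff a) t) := by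
    refine h.congr_fun ?_
    intro n
    rw [shiftCoeff]
    push_cast
    ring
  have h3 := (hasSum_nat_add_iff (f := fun n : ℕ => (n : ℝ) * a n * t ^ n) 1).1 h2
  simpa using h3

theorem IsExpType.hasSum {a : ℕ → ℝ} (ha : IsExpType a) (t : ℝ) :
    HasSum (fun n : ℕ => a n * t ^ n) (expSeries a t) := (ha.summable t).hasSum

/-- `t f(t) = ∑ aₙ tⁿ⁺¹`. -/
theorem IsExpType.hasSum_mul {a : ℕ → ℝ} (ha : IsExpType a) (t : ℝ) :
    HasSum (fun n : ℕ => (if n = 0 then 0 else a (n - 1)) * t ^ n) (t * expSeries a t) := by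
  rw [← add_zero (t * _)]
  have h := (ha.hasSum t).mul_left t
  have h2 : HasSum (fun n : ℕ => (if n + 1 = 0 then 0 else a (n + 1 - 1)) * t ^ (n + 1))
      (t * expSeries a t) := by
    refine h.congr_fun ?_
    intro n
    simp
    ring
  simpa using (hasSum_nat_add_iff
    (f := fun n : ℕ => (if n = 0 then 0 else a (n - 1)) * t ^ n) 1).1 h2

/-! ### The modified Bessel functions of orders zero and one -/

theorem psi_succ (n : ℕ) : psi (n + 1) = psi n + 1 / ((n : ℝ) + 1) := by
  rw [psi, psi, Finset.sum_Icc_succ_top (by omega)]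
  push_cast
  ring

theorem psi_nonneg (n : ℕ) : 0 ≤ psi n := Finset.sum_nonneg fun _ _ => by positivity

theorem psi_le (n : ℕ) : psi n ≤ n := by
  induction n with
  | zero => simp [psi]
  | succ n ih =>
    rw [psi_succ]
    push_cast
    have : 1 / ((n : ℝ) + 1) ≤ 1 := by
      rw [div_le_one (by positivity)]
      linarith [(Nat.cast_nonneg n : (0 : ℝ) ≤ n)]
    linarith

theorem psi_le_factorial (n : ℕ) : psi n ≤ n.factorial :=
  (psi_le n).trans (by exact_mod_cast n.self_le_factorial)

/-- Coefficients of `I₀` as a power series in `t = z² / 4`. -/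
def coeffI0 (n : ℕ) : ℝ := 1 / (n.factorial : ℝ) ^ 2

/-- Coefficients of `2 I₁ / z` as a power series in `t = z² / 4`. -/
def coeffI1 (n : ℕ) : ℝ := 1 / ((n.factorial : ℝ) * ((n + 1).factorial : ℝ))

/-- Coefficients of the regular series in `K₀` as a power series in `t = z² / 4`. -/
def coeffK0 (n : ℕ) : ℝ := psi n / (n.factorial : ℝ) ^ 2

/-- Coefficients of the regular series in `K₁`, divided by `z / 2`, as a power series in
`t = z² / 4`. -/
def coeffK1 (n : ℕ) : ℝ :=
  (psi (n + 1) + psi n) / ((n.factorial : ℝ) * ((n + 1).factorial : ℝ))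

theorem one_le_factorial_cast (n : ℕ) : (1 : ℝ) ≤ n.factorial := by
  exact_mod_cast n.factorial_pos

theorem isExpType_coeffI0 : IsExpType coeffI0 := by
  refine ⟨1, fun n => ?_⟩
  have h := one_le_factorial_cast n
  rw [coeffI0, abs_of_nonneg (by positivity)]
  exact one_div_le_one_div_of_le (by positivity) (by nlinarith)

theorem isExpType_coeffI1 : IsExpType coeffI1 := by
  refine ⟨1, fun n => ?_⟩
  have h := one_le_factorial_cast n
  have h' := one_le_factorial_cast (n + 1)
  rw [coeffI1, abs_of_nonneg (by positivity)]
  exact one_div_le_one_div_of_le (by positivity) (by nlinarith)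

theorem isExpType_coeffK0 : IsExpType coeffK0 := by
  refine ⟨1, fun n => ?_⟩
  have h := one_le_factorial_cast n
  have h1 := psi_nonneg n
  rw [coeffK0, abs_of_nonneg (by positivity), div_le_div_iff₀ (by positivity) (by positivity)]
  nlinarith [psi_le_factorial n]

theorem isExpType_coeffK1 : IsExpType coeffK1 := by
  refine ⟨2, fun n => ?_⟩
  have h := one_le_factorial_cast n
  have h1 := psi_nonneg n
  have h3 := psi_nonneg (n + 1)
  have h2 : psi n ≤ psi (n + 1) := by
    rw [psi_succ]
    have : 0 ≤ 1 / ((n : ℝ) + 1) := by positivity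
    linarith
  rw [coeffK1, abs_of_nonneg (by positivity), div_le_div_iff₀ (by positivity) (by positivity)]
  have h4 := psi_le_factorial (n + 1)
  nlinarith

theorem shiftCoeff_coeffI0 : shiftCoeff coeffI0 = coeffI1 := by
  funext n
  have : (n.factorial : ℝ) ≠ 0 := by positivity
  have h' : (n : ℝ) + 1 ≠ 0 := by positivity
  simp only [shiftCoeff, coeffI0, coeffI1, Nat.factorial_succ]
  push_cast
  field_simp

/-- `(t I)' = I₀` for `I(t) = 2 I₁ / z`, `t = z² / 4`. -/
theorem expSeries_coeffI1_ode (t : ℝ) :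
    expSeries coeffI1 t + t * expSeries (shiftCoeff coeffI1) t = expSeries coeffI0 t := by
  refine ((isExpType_coeffI1.hasSum t).add (isExpType_coeffI1.hasSum_mul_deriv t)).unique ?_
  refine (isExpType_coeffI0.hasSum t).congr_fun ?_
  intro n
  have : (n.factorial : ℝ) ≠ 0 := by positivity
  have h' : (n : ℝ) + 1 ≠ 0 := by positivity
  simp only [coeffI0, coeffI1, Nat.factorial_succ]
  push_cast
  field_simp
  ring

/-- The identity between the regular parts of `K₀' = -K₁`. -/
theorem expSeries_coeffK0_ode (t : ℝ) :
    2 * (t * expSeries (shiftCoeff coeffK0) t) - t * expSeries coeffK1 t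
      = expSeries coeffI0 t - 1 := by
  refine (((isExpType_coeffK0.hasSum_mul_deriv t).mul_left 2).sub
    (isExpType_coeffK1.hasSum_mul t)).unique ?_
  have h0 : HasSum (fun n : ℕ => if n = 0 then (1 : ℝ) else 0) 1 := hasSum_ite_eq 0 1
  refine ((isExpType_coeffI0.hasSum t).sub h0).congr_fun ?_
  intro n
  rcases n with _ | n
  · simp [coeffI0]
  have : (n.factorial : ℝ) ≠ 0 := by positivity
  have h' : (n : ℝ) + 1 ≠ 0 := by positivity
  simp only [coeffI0, coeffK1, coeffK0, Nat.factorial_succ, psi_succ, Nat.add_sub_cancel]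
  simp only [Nat.add_eq_zero_iff, one_ne_zero, and_false, if_false]
  push_cast
  field_simp
  ring

/-- The identity between the regular parts of `(z K₁)' = -z K₀`. -/
theorem expSeries_coeffK1_ode (t : ℝ) :
    expSeries coeffK1 t + t * expSeries (shiftCoeff coeffK1) t
      = expSeries coeffI1 t + 2 * expSeries coeffK0 t := by
  refine ((isExpType_coeffK1.hasSum t).add (isExpType_coeffK1.hasSum_mul_deriv t)).unique ?_
  refine ((isExpType_coeffI1.hasSum t).add
    ((isExpType_coeffK0.hasSum t).mul_left 2)).congr_fun ?_
  intro n
  have : (n.factorial : ℝ) ≠ 0 := by positivity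
  have h' : (n : ℝ) + 1 ≠ 0 := by positivity
  simp only [coeffI1, coeffK1, coeffK0, Nat.factorial_succ, psi_succ]
  push_cast
  field_simp
  ring

theorem isExpType_contDiff {a : ℕ → ℝ} (ha : IsExpType a) : ContDiff ℝ ∞ (expSeries a) :=
  contDiff_infty.2 ha.contDiff

theorem sq_half_pow (z : ℝ) (n : ℕ) : (z / 2) ^ (2 * n) = (z ^ 2 / 4) ^ n := by
  rw [pow_mul]
  congr 1
  ring

theorem besselI0_eq (z : ℝ) : besselI0 z = expSeries coeffI0 (z ^ 2 / 4) :=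
  tsum_congr fun n => by rw [sq_half_pow, coeffI0]

theorem besselI1_eq (z : ℝ) : besselI1 z = z / 2 * expSeries coeffI1 (z ^ 2 / 4) := by
  rw [besselI1, expSeries, ← tsum_mul_left]
  refine tsum_congr fun n => ?_
  rw [pow_succ, sq_half_pow, coeffI1]
  ring

/-- `K₀(g √ρ)` as a function of `ρ`. -/
def radialK0 (g ρ : ℝ) : ℝ :=
  -(Real.log ρ / 2 + (Real.log (g / 2) + Real.eulerMascheroniConstant))
      * expSeries coeffI0 (g ^ 2 / 4 * ρ)
    + expSeries coeffK0 (g ^ 2 / 4 * ρ)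

/-- `√ρ K₁(g √ρ)` as a function of `ρ`. -/
def radialK1 (g ρ : ℝ) : ℝ :=
  1 / g * (1 + (Real.log ρ / 2 + (Real.log (g / 2) + Real.eulerMascheroniConstant))
      * (2 * (g ^ 2 / 4 * ρ) * expSeries coeffI1 (g ^ 2 / 4 * ρ))
    - g ^ 2 / 4 * ρ * expSeries coeffK1 (g ^ 2 / 4 * ρ))

theorem log_mul_half {g r : ℝ} (hg : 0 < g) (hr : 0 < r) :
    Real.log (g * r / 2) = Real.log (r ^ 2) / 2 + Real.log (g / 2) := by
  rw [Real.log_pow, show g * r / 2 = r * (g / 2) by ring,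
    Real.log_mul hr.ne' (by positivity)]
  push_cast
  ring

theorem besselK0_eq {g r : ℝ} (hg : 0 < g) (hr : 0 < r) :
    besselK0 (g * r) = radialK0 g (r ^ 2) := by
  have h : (g * r) ^ 2 / 4 = g ^ 2 / 4 * r ^ 2 := by ring
  rw [besselK0, radialK0, besselI0_eq, log_mul_half hg hr, h]
  congr 1
  · ring
  · refine tsum_congr fun n => ?_
    rw [sq_half_pow, coeffK0, h]

theorem besselK1_eq {g r : ℝ} (hg : 0 < g) (hr : 0 < r) :
    r * besselK1 (g * r) = radialK1 g (r ^ 2) := by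
  have h : (g * r) ^ 2 / 4 = g ^ 2 / 4 * r ^ 2 := by ring
  have hs : ∑' n : ℕ, (psi (n + 1) + psi n) / ((n.factorial : ℝ) * ((n + 1).factorial : ℝ))
      * (g * r / 2) ^ (2 * n + 1) = g * r / 2 * expSeries coeffK1 (g ^ 2 / 4 * r ^ 2) := by
    rw [expSeries, ← tsum_mul_left]
    refine tsum_congr fun n => ?_
    rw [pow_succ, sq_half_pow, coeffK1, h]
    ring
  rw [besselK1, radialK1, hs, besselI1_eq, log_mul_half hg hr, h]
  field_simp
  ring

theorem hasDerivAt_expSeries_comp {a : ℕ → ℝ} (ha : IsExpType a) (b ρ : ℝ) :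
    HasDerivAt (fun ρ => expSeries a (b * ρ)) (b * expSeries (shiftCoeff a) (b * ρ)) ρ := by
  have := (ha.hasDerivAt (b * ρ)).comp ρ ((hasDerivAt_id ρ).const_mul b)
  rw [mul_one, mul_comm] at this
  exact this

theorem hasDerivAt_log_half {ρ : ℝ} (hρ : 0 < ρ) (c0 : ℝ) :
    HasDerivAt (fun ρ => Real.log ρ / 2 + c0) (1 / (2 * ρ)) ρ := by
  refine (((Real.hasDerivAt_log hρ.ne').div_const 2).add_const c0).congr_deriv ?_
  field_simp

/-- `K₀' = -K₁` in the variable `ρ = r²`. -/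
theorem hasDerivAt_radialK0 {g ρ : ℝ} (hg : 0 < g) (hρ : 0 < ρ) :
    HasDerivAt (radialK0 g) (-(g / (2 * ρ)) * radialK1 g ρ) ρ := by
  have h := ((hasDerivAt_log_half hρ
    (Real.log (g / 2) + Real.eulerMascheroniConstant)).neg.mul
    (hasDerivAt_expSeries_comp isExpType_coeffI0 (g ^ 2 / 4) ρ)).add
    (hasDerivAt_expSeries_comp isExpType_coeffK0 (g ^ 2 / 4) ρ)
  refine h.congr_deriv ?_
  have e := expSeries_coeffK0_ode (g ^ 2 / 4 * ρ)
  rw [shiftCoeff_coeffI0, radialK1]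
  rw [show expSeries coeffI0 (g ^ 2 / 4 * ρ) = 1 + (2 * (g ^ 2 / 4 * ρ *
    expSeries (shiftCoeff coeffK0) (g ^ 2 / 4 * ρ)) - g ^ 2 / 4 * ρ *
    expSeries coeffK1 (g ^ 2 / 4 * ρ)) by linarith]
  simp only [Pi.neg_apply]
  field_simp
  ring

/-- `(z K₁)' = -z K₀` in the variable `ρ = r²`. -/
theorem hasDerivAt_radialK1 {g ρ : ℝ} (hg : 0 < g) (hρ : 0 < ρ) :
    HasDerivAt (radialK1 g) (-(g / 2) * radialK0 g ρ) ρ := by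
  have hlin : HasDerivAt (fun ρ : ℝ => g ^ 2 / 4 * ρ) (g ^ 2 / 4) ρ := by
    simpa using (hasDerivAt_id ρ).const_mul (g ^ 2 / 4)
  have h := ((((hasDerivAt_log_half hρ
    (Real.log (g / 2) + Real.eulerMascheroniConstant)).mul
    ((hlin.const_mul 2).mul
      (hasDerivAt_expSeries_comp isExpType_coeffI1 (g ^ 2 / 4) ρ))).const_add 1).sub
    (hlin.mul (hasDerivAt_expSeries_comp isExpType_coeffK1 (g ^ 2 / 4) ρ))).const_mul (1 / g)
  refine h.congr_deriv ?_
  have e1 := expSeries_coeffI1_ode (g ^ 2 / 4 * ρ)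
  have e2 := expSeries_coeffK1_ode (g ^ 2 / 4 * ρ)
  rw [radialK0, ← e1, show expSeries coeffK0 (g ^ 2 / 4 * ρ) = (expSeries coeffK1 (g ^ 2 / 4 * ρ)
    + g ^ 2 / 4 * ρ * expSeries (shiftCoeff coeffK1) (g ^ 2 / 4 * ρ)
    - expSeries coeffI1 (g ^ 2 / 4 * ρ)) / 2 by linarith]
  simp only [Pi.mul_apply]
  field_simp
  ring

/-! ### The polynomial factors and their differential recursion -/

theorem coeffA_of_lt (κ c : ℝ) {n k : ℕ} (h : n < k) : coeffA κ c n k = 0 := by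
  rw [coeffA, if_neg (by omega), if_pos h]

theorem beta_zero_pos {κ c : ℝ} (hκ : 0 < κ) (hc : 0 < c) : 0 < beta κ c 0 := by
  rw [beta]
  positivity

theorem gam_pos {κ c : ℝ} (hκ : 0 < κ) (hc : 0 < c) : 0 < gam κ c :=
  Real.sqrt_pos.2 (beta_zero_pos hκ hc)

/-- The recursion for `a_{n,k}` in a form that holds for all `n` and all `k + 1 ≥ 1`: outside the
triangle both sides vanish. -/
theorem coeffA_recursion {κ c : ℝ} (hg : gam κ c ≠ 0) (n k : ℕ) :
    2 * gam κ c * ((k : ℝ) + 1) * coeffA κ c n (k + 1)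
      = 4 * (((k + 2) / 2 : ℕ) : ℝ) ^ 2 * coeffA κ c n (k + 2)
        - ∑ m ∈ Finset.range n, beta κ c (n - m) * coeffA κ c m k := by
  have hk0 : (k : ℝ) + 1 ≠ 0 := by positivity
  rcases lt_trichotomy (k + 1) n with h | h | h
  · have hsum : ∑ m ∈ Finset.range n, beta κ c (n - m) * coeffA κ c m k
        = ∑ m ∈ Finset.Icc (k + 1 - 1) (n - 1), beta κ c (n - m) * coeffA κ c m (k + 1 - 1) := by
      symm
      refine Finset.sum_subset (fun m hm => ?_) fun m hm hm' => ?_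
      · simp only [Finset.mem_Icc, Finset.mem_range] at *
        omega
      · simp only [Finset.mem_Icc, Finset.mem_range] at *
        rw [coeffA_of_lt κ c (by omega), mul_zero]
    rw [coeffA_rec κ c n (k + 1) (by omega) h, ← hsum]
    push_cast
    field_simp
  · subst h
    rw [coeffA_diag κ c (k + 1) (by omega), coeffA_of_lt κ c (by omega : k + 1 < k + 2),
      Finset.sum_range_succ, Finset.sum_eq_zero fun m hm => ?_]
    · simp only [Nat.add_sub_cancel, Nat.add_sub_cancel_left]
      push_cast
      field_simp
      ring
    · rw [coeffA_of_lt κ c (Finset.mem_range.1 hm), mul_zero]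
  · rw [coeffA_of_lt κ c h, coeffA_of_lt κ c (by omega : n < k + 2), Finset.sum_eq_zero]
    · ring
    · intro m hm
      rw [coeffA_of_lt κ c (by have := Finset.mem_range.1 hm; omega), mul_zero]

open Polynomial in
/-- The polynomial `V_n` with `v_n(r) = V_n(r²)`. -/
def polV (κ c : ℝ) (n : ℕ) : ℝ[X] :=
  ∑ k ∈ Finset.range (n / 2 + 1), monomial k (coeffA κ c n (2 * k))

open Polynomial in
/-- The polynomial `W_n` with `w_n(r) = r W_n(r²)`. -/
def polW (κ c : ℝ) (n : ℕ) : ℝ[X] :=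
  ∑ k ∈ Finset.range ((n + 1) / 2), monomial k (coeffA κ c n (2 * k + 1))

theorem polV_coeff (κ c : ℝ) (n k : ℕ) : (polV κ c n).coeff k = coeffA κ c n (2 * k) := by
  simp only [polV, Polynomial.finsetSum_coeff, Polynomial.coeff_monomial,
    Finset.sum_ite_eq', Finset.mem_range]
  split_ifs with h
  · rfl
  · rw [coeffA_of_lt κ c (by omega)]

theorem polW_coeff (κ c : ℝ) (n k : ℕ) : (polW κ c n).coeff k = coeffA κ c n (2 * k + 1) := by
  simp only [polW, Polynomial.finsetSum_coeff, Polynomial.coeff_monomial,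
    Finset.sum_ite_eq', Finset.mem_range]
  split_ifs with h
  · rfl
  · rw [coeffA_of_lt κ c (by omega)]

theorem polyV_eq (κ c : ℝ) (n : ℕ) (r : ℝ) : polyV κ c n r = (polV κ c n).eval (r ^ 2) := by
  simp [polyV, polV, Polynomial.eval_finsetSum, Polynomial.eval_monomial, pow_mul]

theorem polyW_eq (κ c : ℝ) (n : ℕ) (r : ℝ) : polyW κ c n r = r * (polW κ c n).eval (r ^ 2) := by
  simp only [polyW, polW, Polynomial.eval_finsetSum, Polynomial.eval_monomial,
    Finset.mul_sum]
  refine Finset.sum_congr rfl fun k _ => ?_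
  rw [pow_succ, pow_mul]
  ring

theorem coeff_X_mul_derivative (p : Polynomial ℝ) (k : ℕ) :
    (Polynomial.X * Polynomial.derivative p).coeff k = k * p.coeff k := by
  rcases k with _ | k
  · simp
  · rw [Polynomial.coeff_X_mul, Polynomial.coeff_derivative]
    push_cast
    ring

open Polynomial in
/-- The coefficient of `K₀` in the equation for the profiles. -/
theorem polV_ode {κ c : ℝ} (hg : gam κ c ≠ 0) (n : ℕ) :
    C 4 * derivative (X * derivative (polV κ c n))
        - C (2 * gam κ c) * (polW κ c n + C 2 * (X * derivative (polW κ c n)))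
      = ∑ m ∈ Finset.range n, C (beta κ c (n - m)) * polV κ c m := by
  ext k
  rw [coeff_sub, coeff_C_mul, coeff_C_mul, coeff_add, coeff_C_mul, coeff_X_mul_derivative,
    coeff_derivative, coeff_X_mul_derivative, finsetSum_coeff]
  simp only [coeff_C_mul, polV_coeff, polW_coeff]
  have h := coeffA_recursion hg n (2 * k)
  rw [show (2 * k + 2) / 2 = k + 1 by omega] at h
  rw [show 2 * (k + 1) = 2 * k + 2 by ring]
  push_cast at h ⊢
  linarith

open Polynomial in
/-- The coefficient of `K₁` in the equation for the profiles. -/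
theorem polW_ode {κ c : ℝ} (hg : gam κ c ≠ 0) (n : ℕ) :
    C 4 * derivative (X * derivative (polW κ c n))
        - C (4 * gam κ c) * derivative (polV κ c n)
      = ∑ m ∈ Finset.range n, C (beta κ c (n - m)) * polW κ c m := by
  ext k
  rw [coeff_sub, coeff_C_mul, coeff_C_mul,
    coeff_derivative, coeff_X_mul_derivative, finsetSum_coeff]
  simp only [coeff_C_mul, polV_coeff, polW_coeff, coeff_derivative]
  have h := coeffA_recursion hg n (2 * k + 1)
  rw [show (2 * k + 1 + 2) / 2 = k + 1 by omega] at h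
  rw [show 2 * (k + 1) = 2 * k + 1 + 1 by ring, show 2 * k + 1 + 1 + 1 = 2 * k + 1 + 2 by ring]
  push_cast at h ⊢
  linarith

/-! ### The radial profiles in the variable `ρ = r²` -/

/-- The profile of the fundamental sequence as a function of the squared distance. -/
def profile (κ c : ℝ) (n : ℕ) (ρ : ℝ) : ℝ :=
  radialK0 (gam κ c) ρ * (polV κ c n).eval ρ + radialK1 (gam κ c) ρ * (polW κ c n).eval ρ

theorem fundProfile_eq {κ c : ℝ} (hg : 0 < gam κ c) (n : ℕ) {r : ℝ} (hr : 0 < r) :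
    fundProfile κ c n r = profile κ c n (r ^ 2) := by
  rw [fundProfile, profile, polyV_eq, polyW_eq, besselK0_eq hg hr, ← besselK1_eq hg hr]
  ring

theorem hasDerivAt_profile {κ c : ℝ} (hg : 0 < gam κ c) (n : ℕ) {ρ : ℝ} (hρ : 0 < ρ) :
    HasDerivAt (profile κ c n)
      (1 / ρ * (radialK0 (gam κ c) ρ * (ρ * ((polV κ c n).derivative.eval ρ
          - gam κ c / 2 * (polW κ c n).eval ρ))
        + radialK1 (gam κ c) ρ * (ρ * (polW κ c n).derivative.eval ρ
          - gam κ c / 2 * (polV κ c n).eval ρ))) ρ := by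
  refine (((hasDerivAt_radialK0 hg hρ).mul ((polV κ c n).hasDerivAt ρ)).add
    ((hasDerivAt_radialK1 hg hρ).mul ((polW κ c n).hasDerivAt ρ))).congr_deriv ?_
  field_simp
  ring

theorem hasDerivAt_id_mul_deriv_profile {κ c : ℝ} (hg : 0 < gam κ c) (n : ℕ) {ρ : ℝ}
    (hρ : 0 < ρ) :
    HasDerivAt (fun ρ => ρ * deriv (profile κ c n) ρ)
      (1 / 4 * (gam κ c ^ 2 * profile κ c n ρ
        + ∑ m ∈ Finset.range n, beta κ c (n - m) * profile κ c m ρ)) ρ := by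
  have heq : (fun ρ => ρ * deriv (profile κ c n) ρ) =ᶠ[𝓝 ρ] fun ρ =>
      radialK0 (gam κ c) ρ * ((Polynomial.X * (polV κ c n).derivative).eval ρ
          - gam κ c / 2 * (Polynomial.X * polW κ c n).eval ρ)
        + radialK1 (gam κ c) ρ * ((Polynomial.X * (polW κ c n).derivative).eval ρ
          - gam κ c / 2 * (polV κ c n).eval ρ) := by
    filter_upwards [lt_mem_nhds hρ] with x hx
    rw [(hasDerivAt_profile hg n hx).deriv]
    simp only [Polynomial.eval_mul, Polynomial.eval_X]
    field_simp
  refine HasDerivAt.congr_of_eventuallyEq ?_ heq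
  have hV := congrArg (Polynomial.eval ρ) (polV_ode hg.ne' n)
  have hW := congrArg (Polynomial.eval ρ) (polW_ode hg.ne' n)
  have hsum : ∑ m ∈ Finset.range n, beta κ c (n - m) * profile κ c m ρ
      = radialK0 (gam κ c) ρ * ∑ m ∈ Finset.range n, beta κ c (n - m) * (polV κ c m).eval ρ
        + radialK1 (gam κ c) ρ
          * ∑ m ∈ Finset.range n, beta κ c (n - m) * (polW κ c m).eval ρ := by
    rw [Finset.mul_sum, Finset.mul_sum, ← Finset.sum_add_distrib]
    refine Finset.sum_congr rfl fun m _ => ?_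
    rw [profile]
    ring
  simp only [Polynomial.eval_sub, Polynomial.eval_mul, Polynomial.eval_C, Polynomial.eval_add,
    Polynomial.eval_X, Polynomial.eval_finsetSum, Polynomial.derivative_mul,
    Polynomial.derivative_X, one_mul] at hV hW
  rw [hsum, ← hV, ← hW]
  refine (((hasDerivAt_radialK0 hg hρ).mul
    (((Polynomial.X * (polV κ c n).derivative).hasDerivAt ρ).sub
      (((Polynomial.X * polW κ c n).hasDerivAt ρ).const_mul (gam κ c / 2)))).add
    ((hasDerivAt_radialK1 hg hρ).mul
      (((Polynomial.X * (polW κ c n).derivative).hasDerivAt ρ).sub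
        (((polV κ c n).hasDerivAt ρ).const_mul (gam κ c / 2))))).congr_deriv ?_
  simp only [Polynomial.derivative_mul, Polynomial.derivative_X, Polynomial.eval_mul,
    Polynomial.eval_add, Polynomial.eval_X, one_mul, profile]
  field_simp
  ring

/-- `g` is smooth on `(0, ∞)` up to a logarithm: `g(ρ) = P(ρ) (log ρ) / 2 + Q(ρ)` with smooth `P`,
`Q` and `P(0) = -1`; then `p ↦ g(|p|²)` has the singularity of `-log |p|`. -/
def IsLogProfile (g : ℝ → ℝ) : Prop :=
  ∃ P Q : ℝ → ℝ, ContDiff ℝ ∞ P ∧ ContDiff ℝ ∞ Q ∧ P 0 = -1 ∧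
    ∀ ρ, 0 < ρ → g ρ = P ρ * (Real.log ρ / 2) + Q ρ

theorem isLogProfile_profile (κ c : ℝ) (n : ℕ) : IsLogProfile (profile κ c n) := by
  have hlin : ContDiff ℝ ∞ fun ρ : ℝ => gam κ c ^ 2 / 4 * ρ := by fun_prop
  have hA := (isExpType_contDiff isExpType_coeffI0).comp hlin
  have hB := (isExpType_contDiff isExpType_coeffI1).comp hlin
  have hE := (isExpType_contDiff isExpType_coeffK0).comp hlin
  have hH := (isExpType_contDiff isExpType_coeffK1).comp hlin
  have hV : ContDiff ℝ ∞ fun ρ => (polV κ c n).eval ρ :=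
    (polV κ c n).contDiff_aeval ∞
  have hW : ContDiff ℝ ∞ fun ρ => (polW κ c n).eval ρ :=
    (polW κ c n).contDiff_aeval ∞
  simp only [Function.comp_def] at hA hB hE hH
  refine ⟨fun ρ => -expSeries coeffI0 (gam κ c ^ 2 / 4 * ρ) * (polV κ c n).eval ρ
      + 1 / gam κ c * (2 * (gam κ c ^ 2 / 4 * ρ) * expSeries coeffI1 (gam κ c ^ 2 / 4 * ρ))
        * (polW κ c n).eval ρ,
    fun ρ => (-(Real.log (gam κ c / 2) + Real.eulerMascheroniConstant)
        * expSeries coeffI0 (gam κ c ^ 2 / 4 * ρ)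
        + expSeries coeffK0 (gam κ c ^ 2 / 4 * ρ)) * (polV κ c n).eval ρ
      + 1 / gam κ c * (1 + (Real.log (gam κ c / 2) + Real.eulerMascheroniConstant)
          * (2 * (gam κ c ^ 2 / 4 * ρ) * expSeries coeffI1 (gam κ c ^ 2 / 4 * ρ))
        - gam κ c ^ 2 / 4 * ρ * expSeries coeffK1 (gam κ c ^ 2 / 4 * ρ))
        * (polW κ c n).eval ρ, by fun_prop, by fun_prop, ?_, fun ρ _ => ?_⟩
  · have h0 : expSeries coeffI0 0 = 1 := by
      rw [expSeries, tsum_eq_single 0 fun n hn => by simp [hn]]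
      simp [coeffI0]
    have hV0 : (polV κ c n).eval 0 = 1 := by
      rw [← Polynomial.coeff_zero_eq_eval_zero, polV_coeff, mul_zero, coeffA_zero]
    simp [h0, hV0]
  · rw [profile, radialK0, radialK1]
    ring

theorem IsLogProfile.contDiffOn {g : ℝ → ℝ} (hg : IsLogProfile g) : ContDiffOn ℝ ∞ g (Ioi 0) := by
  obtain ⟨P, Q, hP, hQ, -, h⟩ := hg
  refine ContDiffOn.congr (f := fun ρ => P ρ * (Real.log ρ / 2) + Q ρ) ?_ fun ρ hρ => h ρ hρ
  have hl : ContDiffOn ℝ ∞ Real.log (Ioi 0) :=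
    Real.contDiffOn_log.mono fun x hx => (mem_Ioi.1 hx).ne'
  exact (hP.contDiffOn.mul (hl.div_const 2)).add hQ.contDiffOn

/-- The fundamental logarithmic profile `-log √ρ`. -/
theorem isLogProfile_log : IsLogProfile fun ρ => -(Real.log ρ / 2) :=
  ⟨fun _ => -1, fun _ => 0, contDiff_const, contDiff_const, rfl, fun ρ _ => by ring⟩

theorem IsLogProfile.hasDerivAt {g : ℝ → ℝ} (hg : IsLogProfile g) {ρ : ℝ} (hρ : 0 < ρ) :
    HasDerivAt g (deriv g ρ) ρ :=
  ((hg.contDiffOn.contDiffAt (Ioi_mem_nhds hρ)).differentiableAt (by simp)).hasDerivAt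

theorem IsLogProfile.contDiffOn_deriv {g : ℝ → ℝ} (hg : IsLogProfile g) :
    ContDiffOn ℝ ∞ (deriv g) (Ioi 0) :=
  hg.contDiffOn.deriv_of_isOpen isOpen_Ioi le_rfl

theorem IsLogProfile.contDiffOn_deriv2 {g : ℝ → ℝ} (hg : IsLogProfile g) :
    ContDiffOn ℝ ∞ (deriv (deriv g)) (Ioi 0) :=
  hg.contDiffOn_deriv.deriv_of_isOpen isOpen_Ioi le_rfl

theorem IsLogProfile.hasDerivAt_deriv {g : ℝ → ℝ} (hg : IsLogProfile g) {ρ : ℝ} (hρ : 0 < ρ) :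
    HasDerivAt (deriv g) (deriv (deriv g) ρ) ρ :=
  ((hg.contDiffOn_deriv.contDiffAt (Ioi_mem_nhds hρ)).differentiableAt (by simp)).hasDerivAt

theorem IsLogProfile.hasDerivAt_deriv2 {g : ℝ → ℝ} (hg : IsLogProfile g) {ρ : ℝ} (hρ : 0 < ρ) :
    HasDerivAt (deriv (deriv g)) (deriv (deriv (deriv g)) ρ) ρ :=
  ((hg.contDiffOn_deriv2.contDiffAt (Ioi_mem_nhds hρ)).differentiableAt (by simp)).hasDerivAt

/-- The equation `ΔΦ_n - γ² Φ_n = ∑ β_{n-m} Φ_m` for the radial profile, differentiated once in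
the variable `ρ = r²`. -/
theorem deriv_profile_ode {κ c : ℝ} (hg : 0 < gam κ c) (n : ℕ) {ρ : ℝ} (hρ : 0 < ρ) :
    4 * (ρ * deriv (deriv (deriv (profile κ c n))) ρ + 2 * deriv (deriv (profile κ c n)) ρ)
      = gam κ c ^ 2 * deriv (profile κ c n) ρ
        + ∑ m ∈ Finset.range n, beta κ c (n - m) * deriv (profile κ c m) ρ := by
  have hlp := isLogProfile_profile κ c
  have h1 : ∀ x, 0 < x → deriv (profile κ c n) x + x * deriv (deriv (profile κ c n)) x
      = 1 / 4 * (gam κ c ^ 2 * profile κ c n x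
        + ∑ m ∈ Finset.range n, beta κ c (n - m) * profile κ c m x) := fun x hx => by
    have := ((hasDerivAt_id x).mul ((hlp n).hasDerivAt_deriv hx)).unique
      (hasDerivAt_id_mul_deriv_profile hg n hx)
    simpa using this
  have h2 := ((hlp n).hasDerivAt_deriv hρ).add
    ((hasDerivAt_id ρ).mul ((hlp n).hasDerivAt_deriv2 hρ))
  have h3 : HasDerivAt (fun x => 1 / 4 * (gam κ c ^ 2 * profile κ c n x
        + ∑ m ∈ Finset.range n, beta κ c (n - m) * profile κ c m x))
      (1 / 4 * (gam κ c ^ 2 * deriv (profile κ c n) ρ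
        + ∑ m ∈ Finset.range n, beta κ c (n - m) * deriv (profile κ c m) ρ)) ρ :=
    ((((hlp n).hasDerivAt hρ).const_mul _).add
      (HasDerivAt.fun_sum fun m _ => ((hlp m).hasDerivAt hρ).const_mul _)).const_mul _
  have h4 := h2.unique (h3.congr_of_eventuallyEq
    (by filter_upwards [lt_mem_nhds hρ] with x hx using h1 x hx))
  simp only [id, one_mul] at h4
  linarith

/-- Up to `-1 / (2ρ)` and `1 / (2ρ²)`, the contributions of the fundamental logarithm, the
derivatives of a logarithmic profile have singularities that are integrable along curves. -/
theorem IsLogProfile.bounds {g : ℝ → ℝ} (hg : IsLogProfile g) (M : ℝ) :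
    ∃ C, 0 ≤ C ∧ ∀ ρ, 0 < ρ → ρ ≤ M →
      |deriv g ρ + 1 / (2 * ρ)| ≤ C * ρ ^ (-(1 / 4) : ℝ) ∧
      |deriv (deriv g) ρ - 1 / (2 * ρ ^ 2)| * ρ ≤ C * ρ ^ (-(1 / 4) : ℝ) := by
  obtain ⟨P, Q, hP, hQ, hP0, h⟩ := hg
  have hP' : ContDiff ℝ ∞ (deriv P) := (contDiff_infty_iff_deriv.1 hP).2
  have hQ' : ContDiff ℝ ∞ (deriv Q) := (contDiff_infty_iff_deriv.1 hQ).2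
  have hP'' : ContDiff ℝ ∞ (deriv (deriv P)) := (contDiff_infty_iff_deriv.1 hP').2
  have hQ'' : ContDiff ℝ ∞ (deriv (deriv Q)) := (contDiff_infty_iff_deriv.1 hQ').2
  have dP : ∀ x, HasDerivAt P (deriv P x) x := fun x =>
    (hP.differentiable (by simp) x).hasDerivAt
  have dQ : ∀ x, HasDerivAt Q (deriv Q x) x := fun x =>
    (hQ.differentiable (by simp) x).hasDerivAt
  have dP' : ∀ x, HasDerivAt (deriv P) (deriv (deriv P) x) x := fun x =>
    (hP'.differentiable (by simp) x).hasDerivAt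
  have dQ' : ∀ x, HasDerivAt (deriv Q) (deriv (deriv Q) x) x := fun x =>
    (hQ'.differentiable (by simp) x).hasDerivAt
  have dl : ∀ x : ℝ, 0 < x → HasDerivAt (fun x => Real.log x / 2) (1 / (2 * x)) x :=
    fun x hx => by simpa using hasDerivAt_log_half hx 0
  have d1 : ∀ x, 0 < x →
      deriv g x = deriv P x * (Real.log x / 2) + P x * (1 / (2 * x)) + deriv Q x := fun x hx =>
    ((((dP x).mul (dl x hx)).add (dQ x)).congr_of_eventuallyEq
      (by filter_upwards [lt_mem_nhds hx] with y hy using h y hy)).deriv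
  have d2 : ∀ x, 0 < x → deriv (deriv g) x = deriv (deriv P) x * (Real.log x / 2)
      + deriv P x * (1 / x) - P x * (1 / (2 * x ^ 2)) + deriv (deriv Q) x := fun x hx => by
    have hi : HasDerivAt (fun x : ℝ => 1 / (2 * x)) (-(1 / (2 * x ^ 2))) x := by
      have := ((hasDerivAt_inv hx.ne').const_mul (1 / 2 : ℝ))
      refine (this.congr_of_eventuallyEq (Eventually.of_forall fun y => ?_)).congr_deriv ?_
      · simp only [one_div, mul_inv]
      · field_simp
    rw [((((dP' x).mul (dl x hx)).add ((dP x).mul hi)).add (dQ' x)).congr_of_eventuallyEq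
      (by filter_upwards [lt_mem_nhds hx] with y hy using d1 y hy) |>.deriv]
    field_simp
    ring
  obtain ⟨B, hB⟩ : ∃ B, ∀ x ∈ Icc 0 M, ‖(deriv P x, deriv (deriv P) x, deriv Q x,
      deriv (deriv Q) x)‖ ≤ B :=
    isCompact_Icc.exists_bound_of_continuousOn
      (hP'.continuous.prodMk (hP''.continuous.prodMk
        (hQ'.continuous.prodMk hQ''.continuous))).continuousOn
  have hB1 : ∀ x ∈ Icc 0 M, |deriv P x| ≤ B ∧ |deriv (deriv P) x| ≤ B ∧ |deriv Q x| ≤ B ∧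
      |deriv (deriv Q) x| ≤ B := fun x hx => by
    simpa [Prod.norm_def] using hB x hx
  have hPB : ∀ x, 0 < x → x ≤ M → |P x + 1| ≤ B * x := fun x hx hxM => by
    have := (convex_Icc (0 : ℝ) M).norm_image_sub_le_of_norm_deriv_le (f := P) (x := 0) (y := x)
      (fun y _ => hP.differentiable (by simp) y) (fun y hy => (hB1 y hy).1)
      ⟨le_rfl, hx.le.trans hxM⟩ ⟨hx.le, hxM⟩
    rw [hP0] at this
    simpa [abs_of_pos hx] using this
  -- With `y = x ^ (-1/4)`, the logarithm and the constant `1` are `O(y)` on `(0, M]`.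
  set L : ℝ := 4 * (1 + |M|) with hL
  have hL4 : 4 ≤ L := by linarith [abs_nonneg M]
  have hlog : ∀ x, 0 < x → x ≤ M → |Real.log x| ≤ L * x ^ (-(1 / 4) : ℝ) ∧
      1 ≤ L * x ^ (-(1 / 4) : ℝ) := fun x hx hxM => by
    set y : ℝ := x ^ (-(1 / 4) : ℝ) with hy
    have hy0 : 0 < y := Real.rpow_pos_of_pos hx _
    have hxy : x * y ^ 4 = 1 := by
      rw [hy, ← Real.rpow_natCast, ← Real.rpow_mul hx.le,
        show -(1 / 4 : ℝ) * ((4 : ℕ) : ℝ) = -1 by norm_num, Real.rpow_neg_one,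
        mul_inv_cancel₀ hx.ne']
    have hM0 : 0 < M := hx.trans_le hxM
    have hMM : 1 ≤ M * y ^ 4 := by
      have : 0 < y ^ 4 := by positivity
      nlinarith
    have h1 : 1 ≤ (1 + M) * y := by
      by_contra! hlt
      have hy1 : y ≤ 1 := by nlinarith
      have : y ^ 4 ≤ y := by
        calc y ^ 4 ≤ y ^ 1 := pow_le_pow_of_le_one hy0.le hy1 (by norm_num)
          _ = y := pow_one y
      nlinarith
    have hlogy : Real.log x = -4 * Real.log y := by
      rw [hy, Real.log_rpow hx]
      ring
    rw [abs_of_pos hM0] at hL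
    refine ⟨?_, by rw [hL]; linarith⟩
    have hl1 : Real.log y ≤ y := (Real.log_le_sub_one_of_pos hy0).trans (by linarith)
    have hl2 : -Real.log y ≤ y⁻¹ - 1 := by
      rw [← Real.log_inv]
      exact Real.log_le_sub_one_of_pos (by positivity)
    -- For `y < 1` this follows from `-log y ≤ 1 / y = x y³ ≤ M y`.
    have hl4 : -Real.log y ≤ (1 + M) * y := by
      by_cases hy1 : 1 ≤ y
      · have := Real.log_nonneg hy1
        nlinarith
      · have hy1 : y < 1 := not_le.1 hy1
        have h5 : y⁻¹ ≤ M * y ^ 3 := by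
          rw [inv_le_iff_one_le_mul₀ hy0]
          linarith only [hMM, show M * y ^ 4 = M * y ^ 3 * y by ring]
        have h6 : y ^ 3 ≤ y := by
          calc y ^ 3 ≤ y ^ 1 := pow_le_pow_of_le_one hy0.le hy1.le (by norm_num)
            _ = y := pow_one y
        nlinarith
    rw [hlogy, hL, abs_le]
    constructor <;> nlinarith
  have hB0 : ∀ x, 0 < x → x ≤ M → 0 ≤ B := fun x hx hxM =>
    (abs_nonneg _).trans (hB1 x ⟨hx.le, hxM⟩).1
  refine ⟨|B| * L * (3 * (1 + |M|)), by positivity, fun ρ hρ hρM => ?_⟩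
  have hBn := hB0 ρ hρ hρM
  obtain ⟨b1, b2, b3, b4⟩ := hB1 ρ ⟨hρ.le, hρM⟩
  obtain ⟨l1, l2⟩ := hlog ρ hρ hρM
  have b5 := hPB ρ hρ hρM
  rw [abs_of_nonneg hBn, abs_of_pos (hρ.trans_le hρM)]
  set y : ℝ := L * ρ ^ (-(1 / 4) : ℝ) with hy
  have hy0 : 0 < y := by linarith
  have b6 : |(P ρ + 1) / (2 * ρ)| ≤ B / 2 := by
    rw [abs_div, abs_of_pos (by positivity : 0 < 2 * ρ), div_le_iff₀ (by positivity)]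
    linarith
  have hBy : B ≤ B * y := le_mul_of_one_le_right hBn l2
  have key : B * L * (3 * (1 + M)) * ρ ^ (-(1 / 4) : ℝ) = B * y * (3 * (1 + M)) := by
    rw [hy]
    ring
  have hM0 : 0 < M := hρ.trans_le hρM
  have hByM : 0 ≤ B * y * M := by positivity
  rw [key]
  constructor
  · rw [d1 ρ hρ, show deriv P ρ * (Real.log ρ / 2) + P ρ * (1 / (2 * ρ)) + deriv Q ρ + 1 / (2 * ρ)
      = deriv P ρ * Real.log ρ / 2 + (P ρ + 1) / (2 * ρ) + deriv Q ρ by field_simp; ring]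
    have e1 : |deriv P ρ * Real.log ρ / 2| ≤ B * y / 2 := by
      rw [abs_div, abs_mul, abs_two]
      gcongr
    refine (abs_add_three _ _ _).trans ?_
    nlinarith
  · rw [← abs_of_pos hρ, ← abs_mul, abs_of_pos hρ, d2 ρ hρ,
      show (deriv (deriv P) ρ * (Real.log ρ / 2) + deriv P ρ * (1 / ρ) - P ρ * (1 / (2 * ρ ^ 2))
        + deriv (deriv Q) ρ - 1 / (2 * ρ ^ 2)) * ρ
      = (ρ * (deriv (deriv P) ρ * Real.log ρ / 2) + deriv P ρ)
        + (-((P ρ + 1) / (2 * ρ)) + ρ * deriv (deriv Q) ρ) by field_simp; ring]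
    have e1 : |ρ * (deriv (deriv P) ρ * Real.log ρ / 2)| ≤ M * (B * y / 2) := by
      rw [abs_mul, abs_div, abs_mul, abs_two, abs_of_pos hρ]
      gcongr
    have e2 : |ρ * deriv (deriv Q) ρ| ≤ M * B := by
      rw [abs_mul, abs_of_pos hρ]
      gcongr
    refine (abs_add_le _ _).trans ?_
    refine (add_le_add (abs_add_le _ _) (abs_add_le _ _)).trans ?_
    rw [abs_neg]
    have : M * B ≤ M * (B * y) := by gcongr
    nlinarith

/-! ### Layer potentials off the curve -/

/-- The layer potential `∫ c(s) φ(x - z(s)) ds` with kernel `φ` over one period of the curve `z`. -/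
def layer {F : Type} [NormedAddCommGroup F] [NormedSpace ℝ F] (z : ℝ → Plane) (c : ℝ → ℝ)
    (φ : Plane → F) (x : Plane) : F :=
  ∫ s in (0 : ℝ)..(2 * Real.pi), c s • φ (x - z s)

theorem isClosed_range_of_periodic {z : ℝ → Plane} (hz : Continuous z)
    (hp : Function.Periodic z (2 * Real.pi)) : IsClosed (range z) := by
  rw [← hp.image_Icc Real.two_pi_pos 0]
  exact (isCompact_Icc.image hz).isClosed

theorem sub_mem_compl_zero {z : ℝ → Plane} {x : Plane} (hx : x ∉ range z) (s : ℝ) :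
    x - z s ∈ ({0}ᶜ : Set Plane) := fun h => hx ⟨s, (sub_eq_zero.1 h).symm⟩

section layer

variable {F : Type} [NormedAddCommGroup F] [NormedSpace ℝ F] {z : ℝ → Plane} {c : ℝ → ℝ}
  {φ ψ : Plane → F} {x : Plane}

theorem continuous_layer_integrand (hz : Continuous z) (hc : Continuous c)
    (hφ : ContinuousOn φ {0}ᶜ) (hx : x ∉ range z) : Continuous fun s => c s • φ (x - z s) :=
  hc.smul (hφ.comp_continuous (by fun_prop) fun s => sub_mem_compl_zero hx s)

theorem hasFDerivAt_layer (hz : Continuous z) (hp : Function.Periodic z (2 * Real.pi))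
    (hc : Continuous c) (hφ : ContDiffOn ℝ ∞ φ {0}ᶜ) (hx : x ∉ range z) :
    HasFDerivAt (layer z c φ) (layer z c (fderiv ℝ φ) x) x := by
  have hopen : IsOpen (range z)ᶜ := (isClosed_range_of_periodic hz hp).isOpen_compl
  have h0 : IsOpen ({0}ᶜ : Set Plane) := isOpen_compl_singleton
  have hφ' : ContinuousOn (fderiv ℝ φ) {0}ᶜ :=
    (hφ.fderiv_of_isOpen (m := ∞) h0 le_rfl).continuousOn
  obtain ⟨ε, hε, hball⟩ := Metric.nhds_basis_closedBall.mem_iff.1 (hopen.mem_nhds hx)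
  have hcont : ContinuousOn (fun p : Plane × ℝ => c p.2 • fderiv ℝ φ (p.1 - z p.2))
      (Metric.closedBall x ε ×ˢ Icc 0 (2 * Real.pi)) := by
    refine (hc.comp continuous_snd).continuousOn.smul (hφ'.comp (by fun_prop) ?_)
    rintro ⟨y, s⟩ ⟨hy, -⟩
    exact sub_mem_compl_zero (hball hy) s
  obtain ⟨B, hB⟩ := ((isCompact_closedBall x ε).prod
    isCompact_Icc).exists_bound_of_continuousOn hcont
  refine intervalIntegral.hasFDerivAt_integral_of_dominated_of_fderiv_le
    (F := fun x s => c s • φ (x - z s)) (F' := fun x s => c s • fderiv ℝ φ (x - z s))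
    (bound := fun _ => B) (Metric.closedBall_mem_nhds x hε) ?_ ?_ ?_ ?_ ?_ ?_
  · filter_upwards [hopen.mem_nhds hx] with y hy
    exact (continuous_layer_integrand hz hc hφ.continuousOn hy).aestronglyMeasurable
  · exact (continuous_layer_integrand hz hc hφ.continuousOn hx).intervalIntegrable _ _
  · exact (continuous_layer_integrand hz hc hφ' hx).aestronglyMeasurable
  · refine Eventually.of_forall fun s hs y hy => hB (y, s) ⟨hy, ?_⟩
    rw [uIoc_of_le Real.two_pi_pos.le] at hs
    exact Ioc_subset_Icc_self hs
  · exact intervalIntegrable_const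
  · refine Eventually.of_forall fun s _ y hy => HasFDerivAt.const_smul ?_ _
    have hd : HasFDerivAt φ (fderiv ℝ φ (y - z s)) (y - z s) :=
      ((hφ.contDiffAt (h0.mem_nhds (sub_mem_compl_zero (hball hy) s))).differentiableAt
        (by simp)).hasFDerivAt
    have hcomp := hd.comp y ((hasFDerivAt_id y).sub_const (z s))
    rwa [ContinuousLinearMap.comp_id] at hcomp

theorem contDiffOn_layer (hz : Continuous z) (hp : Function.Periodic z (2 * Real.pi))
    (hc : Continuous c) (hφ : ContDiffOn ℝ ∞ φ {0}ᶜ) (n : ℕ) :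
    ContDiffOn ℝ n (layer z c φ) (range z)ᶜ := by
  have hopen : IsOpen (range z)ᶜ := (isClosed_range_of_periodic hz hp).isOpen_compl
  induction n generalizing F with
  | zero =>
    exact contDiffOn_zero.2 fun x hx =>
      (hasFDerivAt_layer hz hp hc hφ hx).continuousAt.continuousWithinAt
  | succ n ih =>
    push_cast
    refine (contDiffOn_succ_iff_fderiv_of_isOpen hopen).2
      ⟨fun x hx => (hasFDerivAt_layer hz hp hc hφ hx).differentiableAt.differentiableWithinAt,
        by simp, ?_⟩
    exact (ih (hφ.fderiv_of_isOpen (m := ∞) isOpen_compl_singleton le_rfl)).congr fun x hx =>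
      (hasFDerivAt_layer hz hp hc hφ hx).fderiv

theorem layer_congr (h : EqOn φ ψ {0}ᶜ) (hx : x ∉ range z) : layer z c φ x = layer z c ψ x :=
  intervalIntegral.integral_congr fun s _ => by
    simp only [h (sub_mem_compl_zero hx s)]

theorem layer_add (hz : Continuous z) (hc : Continuous c) (hφ : ContinuousOn φ {0}ᶜ)
    (hψ : ContinuousOn ψ {0}ᶜ) (hx : x ∉ range z) :
    layer z c (fun p => φ p + ψ p) x = layer z c φ x + layer z c ψ x := by
  simp only [layer, smul_add]
  exact intervalIntegral.integral_add
    ((continuous_layer_integrand hz hc hφ hx).intervalIntegrable _ _)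
    ((continuous_layer_integrand hz hc hψ hx).intervalIntegrable _ _)

theorem layer_smul (b : ℝ) : layer z c (fun p => b • φ p) x = b • layer z c φ x := by
  simp only [layer, smul_comm _ b]
  exact intervalIntegral.integral_smul b _

theorem layer_sum {ι : Type} (t : Finset ι) {φ : ι → Plane → F} (hz : Continuous z)
    (hc : Continuous c) (hφ : ∀ i ∈ t, ContinuousOn (φ i) {0}ᶜ) (hx : x ∉ range z) :
    layer z c (fun p => ∑ i ∈ t, φ i p) x = ∑ i ∈ t, layer z c (φ i) x := by
  simp only [layer, Finset.smul_sum]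
  exact intervalIntegral.integral_finsetSum fun i hi =>
    (continuous_layer_integrand hz hc (hφ i hi) hx).intervalIntegrable _ _

end layer

theorem fderiv_layer_apply {z : ℝ → Plane} {c : ℝ → ℝ} {φ : Plane → ℝ} {x : Plane}
    (hz : Continuous z) (hp : Function.Periodic z (2 * Real.pi))
    (hc : Continuous c) (hφ : ContDiffOn ℝ ∞ φ {0}ᶜ) (hx : x ∉ range z) (e : Plane) :
    fderiv ℝ (layer z c φ) x e = layer z c (fun p => fderiv ℝ φ p e) x := by
  have hφ' : ContinuousOn (fderiv ℝ φ) {0}ᶜ :=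
    (hφ.fderiv_of_isOpen (m := ∞) isOpen_compl_singleton le_rfl).continuousOn
  rw [(hasFDerivAt_layer hz hp hc hφ hx).fderiv, layer, layer]
  rw [ContinuousLinearMap.intervalIntegral_apply
    ((continuous_layer_integrand hz hc hφ' hx).intervalIntegrable _ _)]
  simp

/-- The coordinate vectors of the plane. -/
def stdVec (i : Fin 2) : Plane := EuclideanSpace.single i 1

theorem laplacian_eq_sum_fderiv {f : Plane → ℝ} {x : Plane} (hf : ContDiffAt ℝ 2 f x) :
    Laplacian.laplacian f x
      = ∑ i, fderiv ℝ (fun y => fderiv ℝ f y (stdVec i)) x (stdVec i) := by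
  have hd : DifferentiableAt ℝ (fderiv ℝ f) x :=
    (hf.fderiv_right (m := 1) (by norm_num)).differentiableAt (by simp)
  rw [InnerProductSpace.laplacian_eq_iteratedFDeriv_orthonormalBasis f
    (EuclideanSpace.basisFun (Fin 2) ℝ)]
  refine Finset.sum_congr rfl fun i _ => ?_
  rw [iteratedFDeriv_two_apply, fderiv_clm_apply hd (differentiableAt_const _)]
  simp [stdVec]

theorem contDiffOn_fderiv_apply {φ : Plane → ℝ} (hφ : ContDiffOn ℝ ∞ φ {0}ᶜ) (e : Plane) :
    ContDiffOn ℝ ∞ (fun p => fderiv ℝ φ p e) {0}ᶜ :=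
  (hφ.fderiv_of_isOpen (m := ∞) isOpen_compl_singleton le_rfl).clm_apply contDiffOn_const

theorem laplacian_layer {z : ℝ → Plane} {c : ℝ → ℝ} {φ : Plane → ℝ} {x : Plane}
    (hz : Continuous z) (hp : Function.Periodic z (2 * Real.pi))
    (hc : Continuous c) (hφ : ContDiffOn ℝ ∞ φ {0}ᶜ) (hx : x ∉ range z) :
    Laplacian.laplacian (layer z c φ) x = layer z c (Laplacian.laplacian φ) x := by
  have hopen : IsOpen (range z)ᶜ := (isClosed_range_of_periodic hz hp).isOpen_compl
  rw [laplacian_eq_sum_fderiv ((contDiffOn_layer hz hp hc hφ 2).contDiffAt (hopen.mem_nhds hx))]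
  have hstep : ∀ i, fderiv ℝ (fun y => fderiv ℝ (layer z c φ) y (stdVec i)) x (stdVec i)
      = layer z c (fun p => fderiv ℝ (fun y => fderiv ℝ φ y (stdVec i)) p (stdVec i)) x := by
    intro i
    have he : (fun y => fderiv ℝ (layer z c φ) y (stdVec i))
        =ᶠ[𝓝 x] layer z c fun p => fderiv ℝ φ p (stdVec i) := by
      filter_upwards [hopen.mem_nhds hx] with y hy
      exact fderiv_layer_apply hz hp hc hφ hy _
    rw [he.fderiv_eq, fderiv_layer_apply hz hp hc (contDiffOn_fderiv_apply hφ _) hx]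
  simp only [hstep]
  rw [← layer_sum _ hz hc (fun i _ => (contDiffOn_fderiv_apply
    (contDiffOn_fderiv_apply hφ _) _).continuousOn) hx]
  refine layer_congr (fun p hp => ?_) hx
  exact (laplacian_eq_sum_fderiv ((contDiffOn_infty.1 hφ 2).contDiffAt
    (isOpen_compl_singleton.mem_nhds hp))).symm

/-! ### The dipole kernel of a radial profile -/

/-- The derivative of `p ↦ g(|p|²)` in the direction `v`. -/
def dipole (g : ℝ → ℝ) (v p : Plane) : ℝ := 2 * deriv g (‖p‖ ^ 2) * ⟪p, v⟫

/-- The derivative of `dipole g v` in the direction `e`. -/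
def dipoleDeriv (g : ℝ → ℝ) (v e p : Plane) : ℝ :=
  4 * deriv (deriv g) (‖p‖ ^ 2) * ⟪p, e⟫ * ⟪p, v⟫ + 2 * deriv g (‖p‖ ^ 2) * ⟪e, v⟫

theorem norm_sq_pos_of_mem {p : Plane} (hp : p ∈ ({0}ᶜ : Set Plane)) : 0 < ‖p‖ ^ 2 := by
  have : p ≠ 0 := hp
  positivity

theorem hasFDerivAt_comp_norm_sq {g : ℝ → ℝ} {g' : ℝ} {p : Plane}
    (hg : HasDerivAt g g' (‖p‖ ^ 2)) :
    HasFDerivAt (fun p : Plane => g (‖p‖ ^ 2)) (g' • (2 : ℝ) • innerSL ℝ p) p := by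
  have h := hg.comp_hasFDerivAt p (hasStrictFDerivAt_norm_sq p).hasFDerivAt
  refine h.congr_fderiv ?_
  congr 1
  ext v
  simp [two_smul]

theorem hasFDerivAt_inner_right (v p : Plane) :
    HasFDerivAt (fun p : Plane => ⟪p, v⟫) (innerSL ℝ v) p := by
  refine (innerSL ℝ v).hasFDerivAt.congr_of_eventuallyEq (Eventually.of_forall fun q => ?_)
  simp [real_inner_comm]

theorem IsLogProfile.hasFDerivAt_dipole {g : ℝ → ℝ} (hg : IsLogProfile g) (v : Plane) {p : Plane}
    (hp : p ∈ ({0}ᶜ : Set Plane)) :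
    HasFDerivAt (dipole g v)
      ((4 * deriv (deriv g) (‖p‖ ^ 2) * ⟪p, v⟫) • innerSL ℝ p
        + (2 * deriv g (‖p‖ ^ 2)) • innerSL ℝ v) p := by
  have h := ((hasFDerivAt_comp_norm_sq
    (hg.hasDerivAt_deriv (norm_sq_pos_of_mem hp))).const_mul 2).mul (hasFDerivAt_inner_right v p)
  refine h.congr_fderiv ?_
  ext e
  simp
  ring

theorem IsLogProfile.fderiv_dipole {g : ℝ → ℝ} (hg : IsLogProfile g) (v e : Plane) {p : Plane}
    (hp : p ∈ ({0}ᶜ : Set Plane)) : fderiv ℝ (dipole g v) p e = dipoleDeriv g v e p := by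
  rw [(hg.hasFDerivAt_dipole v hp).fderiv, dipoleDeriv]
  simp [real_inner_comm e v]
  ring

theorem contDiffOn_comp_norm_sq {g : ℝ → ℝ} (hg : ContDiffOn ℝ ∞ g (Ioi 0)) :
    ContDiffOn ℝ ∞ (fun p : Plane => g (‖p‖ ^ 2)) {0}ᶜ :=
  hg.comp (contDiff_norm_sq ℝ).contDiffOn fun _ hp => norm_sq_pos_of_mem hp

theorem IsLogProfile.contDiffOn_dipole {g : ℝ → ℝ} (hg : IsLogProfile g) (v : Plane) :
    ContDiffOn ℝ ∞ (dipole g v) {0}ᶜ :=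
  (contDiffOn_const.mul (contDiffOn_comp_norm_sq hg.contDiffOn_deriv)).mul
    (contDiff_id.inner ℝ contDiff_const).contDiffOn

theorem sum_inner_stdVec (p v : Plane) : ∑ i, ⟪p, stdVec i⟫ * ⟪stdVec i, v⟫ = ⟪p, v⟫ := by
  simp [stdVec, PiLp.inner_apply, mul_comm]

theorem IsLogProfile.laplacian_dipole {g : ℝ → ℝ} (hg : IsLogProfile g) (v : Plane) {p : Plane}
    (hp : p ∈ ({0}ᶜ : Set Plane)) :
    Laplacian.laplacian (dipole g v) p
      = 8 * (‖p‖ ^ 2 * deriv (deriv (deriv g)) (‖p‖ ^ 2) + 2 * deriv (deriv g) (‖p‖ ^ 2))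
        * ⟪p, v⟫ := by
  have hpos := norm_sq_pos_of_mem hp
  rw [laplacian_eq_sum_fderiv ((contDiffOn_infty.1 (hg.contDiffOn_dipole v) 2).contDiffAt
    (isOpen_compl_singleton.mem_nhds hp))]
  have hstep : ∀ i, fderiv ℝ (fun y => fderiv ℝ (dipole g v) y (stdVec i)) p (stdVec i)
      = 8 * deriv (deriv (deriv g)) (‖p‖ ^ 2) * ⟪p, v⟫ * (⟪p, stdVec i⟫ * ⟪stdVec i, p⟫)
        + 4 * deriv (deriv g) (‖p‖ ^ 2) * ⟪p, v⟫ * ⟪stdVec i, stdVec i⟫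
        + 8 * deriv (deriv g) (‖p‖ ^ 2) * (⟪p, stdVec i⟫ * ⟪stdVec i, v⟫) := by
    intro i
    have he : (fun y => fderiv ℝ (dipole g v) y (stdVec i))
        =ᶠ[𝓝 p] dipoleDeriv g v (stdVec i) := by
      filter_upwards [isOpen_compl_singleton.mem_nhds hp] with y hy
      exact hg.fderiv_dipole v _ hy
    rw [he.fderiv_eq]
    have h := ((((hasFDerivAt_comp_norm_sq (hg.hasDerivAt_deriv2 hpos)).const_mul 4).mul
      (hasFDerivAt_inner_right (stdVec i) p)).mul (hasFDerivAt_inner_right v p)).add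
      (((hasFDerivAt_comp_norm_sq (hg.hasDerivAt_deriv hpos)).const_mul 2).mul_const
        ⟪stdVec i, v⟫)
    have h' : HasFDerivAt (dipoleDeriv g v (stdVec i)) _ p := h
    rw [h'.fderiv]
    simp [real_inner_comm p (stdVec i), real_inner_comm v (stdVec i)]
    ring
  simp only [hstep, Finset.sum_add_distrib, ← Finset.mul_sum, sum_inner_stdVec]
  have h2 : ∑ i, ⟪stdVec i, stdVec i⟫ = (2 : ℝ) := by simp [stdVec]
  rw [h2, real_inner_self_eq_norm_sq]
  ring

/-! ### Double-layer potentials of radial profiles -/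

/-- The normal `(z₂', -z₁')` of the curve `z`, with the length of `z'`. -/
def nvec (z : ℝ → Plane) (s : ℝ) : Plane := !₂[deriv z s 1, -(deriv z s 0)]

/-- The double-layer potential with density `w` (a function of the parameter) over one closed
curve, for the kernel `g(|x - y|²)`; the speed of the curve is absorbed in `nvec`. -/
def dlp (g : ℝ → ℝ) (z : ℝ → Plane) (w : ℝ → ℝ) (x : Plane) : ℝ :=
  -∫ s in (0 : ℝ)..(2 * Real.pi), w s * dipole g (nvec z s) (x - z s)

theorem continuous_nvec_apply {z : ℝ → Plane} (hz : ContDiff ℝ 1 z) (i : Fin 2) :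
    Continuous fun s => nvec z s i := by
  have h : Continuous (deriv z) := hz.continuous_deriv le_rfl
  have h' : ∀ j, Continuous fun s => deriv z s j := fun j => by fun_prop
  fin_cases i
  · exact h' 1
  · exact (h' 0).neg

theorem continuous_density {z : ℝ → Plane} {w : ℝ → ℝ} (hz : ContDiff ℝ 1 z) (hw : Continuous w)
    (i : Fin 2) : Continuous fun s => w s * nvec z s i :=
  hw.mul (continuous_nvec_apply hz i)

theorem continuous_nvec {z : ℝ → Plane} (hz : ContDiff ℝ 1 z) : Continuous (nvec z) := by
  rw [show nvec z = fun s => WithLp.toLp 2 fun i => nvec z s i from rfl]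
  exact (PiLp.continuous_toLp 2 _).comp (continuous_pi fun i => continuous_nvec_apply hz i)

theorem eq_sum_stdVec (v : Plane) : v = ∑ i, v i • stdVec i := by
  ext j
  fin_cases j <;> simp [stdVec]

theorem dipole_eq_sum (g : ℝ → ℝ) (v p : Plane) :
    dipole g v p = ∑ i, v i * dipole g (stdVec i) p := by
  conv_lhs => rw [eq_sum_stdVec v]
  simp only [dipole, Fin.sum_univ_two, inner_add_right, inner_smul_right]
  ring

theorem dipoleDeriv_eq_sum (g : ℝ → ℝ) (v e p : Plane) :
    dipoleDeriv g v e p = ∑ i, v i * dipoleDeriv g (stdVec i) e p := by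
  conv_lhs => rw [eq_sum_stdVec v]
  simp only [dipoleDeriv, Fin.sum_univ_two, inner_add_right, inner_smul_right]
  ring

section dlp

variable {g : ℝ → ℝ} {z : ℝ → Plane} {w : ℝ → ℝ} {x : Plane}

theorem IsLogProfile.dlp_eq (hg : IsLogProfile g) (hz : ContDiff ℝ 1 z) (hw : Continuous w)
    (hx : x ∉ range z) :
    dlp g z w x = -∑ i, layer z (fun s => w s * nvec z s i) (dipole g (stdVec i)) x := by
  rw [dlp]
  simp only [layer]
  rw [← intervalIntegral.integral_finsetSum fun i _ => (continuous_layer_integrand hz.continuous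
    (continuous_density hz hw i) (hg.contDiffOn_dipole _).continuousOn
      hx).intervalIntegrable _ _]
  congr 1
  refine intervalIntegral.integral_congr fun s _ => ?_
  simp only [smul_eq_mul, dipole_eq_sum g (nvec z s), Finset.mul_sum, mul_assoc]

theorem IsLogProfile.contDiffOn_dlp (hg : IsLogProfile g) (hz : ContDiff ℝ 1 z)
    (hp : Function.Periodic z (2 * Real.pi)) (hw : Continuous w) (n : ℕ) :
    ContDiffOn ℝ n (dlp g z w) (range z)ᶜ := by
  refine ContDiffOn.congr (ContDiffOn.neg (ContDiffOn.sum fun i _ =>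
    contDiffOn_layer hz.continuous hp (continuous_density hz hw i)
      (hg.contDiffOn_dipole (stdVec i)) n)) fun x hx => hg.dlp_eq hz hw hx

theorem IsLogProfile.fderiv_dlp (hg : IsLogProfile g) (hz : ContDiff ℝ 1 z)
    (hp : Function.Periodic z (2 * Real.pi)) (hw : Continuous w) (hx : x ∉ range z) (e : Plane) :
    fderiv ℝ (dlp g z w) x e
      = -∫ s in (0 : ℝ)..(2 * Real.pi), w s * dipoleDeriv g (nvec z s) e (x - z s) := by
  have hopen : IsOpen (range z)ᶜ := (isClosed_range_of_periodic hz.continuous hp).isOpen_compl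
  have he : dlp g z w =ᶠ[𝓝 x]
      fun x => -∑ i, layer z (fun s => w s * nvec z s i) (dipole g (stdVec i)) x := by
    filter_upwards [hopen.mem_nhds hx] with y hy using hg.dlp_eq hz hw hy
  have hc := fun i => continuous_density hz hw i
  rw [he.fderiv_eq, fderiv_fun_neg, fderiv_fun_sum fun i _ => (hasFDerivAt_layer hz.continuous hp
    (hc i) (hg.contDiffOn_dipole (stdVec i)) hx).differentiableAt]
  simp only [neg_apply, sum_apply]
  congr 1
  have hint : ∀ i, layer z (fun s => w s * nvec z s i)
      (fun p => fderiv ℝ (dipole g (stdVec i)) p e) x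
      = ∫ s in (0 : ℝ)..(2 * Real.pi), w s * (nvec z s i
        * fderiv ℝ (dipole g (stdVec i)) (x - z s) e) := fun i => by
    simp only [layer, smul_eq_mul, mul_assoc]
  simp only [fderiv_layer_apply hz.continuous hp (hc _) (hg.contDiffOn_dipole (stdVec _)) hx, hint]
  rw [← intervalIntegral.integral_finsetSum fun i _ => ?_]
  · refine intervalIntegral.integral_congr fun s _ => ?_
    simp only [dipoleDeriv_eq_sum g (nvec z s), Finset.mul_sum]
    refine Finset.sum_congr rfl fun i _ => ?_
    rw [hg.fderiv_dipole _ _ (sub_mem_compl_zero hx s)]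
  · have := (continuous_layer_integrand hz.continuous (hc i) (contDiffOn_fderiv_apply
      (hg.contDiffOn_dipole (stdVec i)) e).continuousOn hx).intervalIntegrable (μ :=
      MeasureTheory.volume) 0 (2 * Real.pi)
    simpa only [smul_eq_mul, mul_assoc] using this

end dlp

/-- The double-layer potentials of the fundamental sequence satisfy the differential equations off
the curve. -/
theorem laplacian_dlp_profile {κ c : ℝ} (hγ : 0 < gam κ c) {z : ℝ → Plane} {w : ℝ → ℝ} {x : Plane}
    (hz : ContDiff ℝ 1 z) (hp : Function.Periodic z (2 * Real.pi)) (hw : Continuous w)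
    (hx : x ∉ range z) (n : ℕ) :
    Laplacian.laplacian (dlp (profile κ c n) z w) x
      = gam κ c ^ 2 * dlp (profile κ c n) z w x
        + ∑ m ∈ Finset.range n, beta κ c (n - m) * dlp (profile κ c m) z w x := by
  have hg := fun n => isLogProfile_profile κ c n
  have hopen : IsOpen (range z)ᶜ := (isClosed_range_of_periodic hz.continuous hp).isOpen_compl
  have he : dlp (profile κ c n) z w =ᶠ[𝓝 x] -(
      layer z (fun s => w s * nvec z s 0) (dipole (profile κ c n) (stdVec 0))
      + layer z (fun s => w s * nvec z s 1) (dipole (profile κ c n) (stdVec 1))) := by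
    filter_upwards [hopen.mem_nhds hx] with y hy
    rw [(hg n).dlp_eq hz hw hy, Fin.sum_univ_two]
    rfl
  have hc := fun i => continuous_density hz hw i
  have hsm := fun i => (contDiffOn_layer hz.continuous hp (hc i)
    ((hg n).contDiffOn_dipole (stdVec i)) 2).contDiffAt (hopen.mem_nhds hx)
  have hlap : ∀ i, Laplacian.laplacian
      (layer z (fun s => w s * nvec z s i) (dipole (profile κ c n) (stdVec i))) x
      = gam κ c ^ 2 * layer z (fun s => w s * nvec z s i) (dipole (profile κ c n) (stdVec i)) x
        + ∑ m ∈ Finset.range n, beta κ c (n - m)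
          * layer z (fun s => w s * nvec z s i) (dipole (profile κ c m) (stdVec i)) x := by
    intro i
    rw [laplacian_layer hz.continuous hp (hc i) ((hg n).contDiffOn_dipole (stdVec i)) hx]
    have hcd := fun m => ((hg m).contDiffOn_dipole (stdVec i)).continuousOn
    have hcs : ∀ m (b : ℝ), ContinuousOn (fun p => b • dipole (profile κ c m) (stdVec i) p) {0}ᶜ :=
      fun m b => (hcd m).const_smul b
    have hterm : ∀ m (b : ℝ), b * layer z (fun s => w s * nvec z s i)
        (dipole (profile κ c m) (stdVec i)) x = layer z (fun s => w s * nvec z s i)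
        (fun p => b • dipole (profile κ c m) (stdVec i) p) x := fun m b => by
      rw [layer_smul, smul_eq_mul]
    simp only [hterm]
    rw [← layer_sum _ hz.continuous (hc i) (fun m _ => hcs m _) hx,
      ← layer_add hz.continuous (hc i) (hcs n _)
        (continuousOn_finsetSum _ fun m _ => hcs m _) hx]
    refine layer_congr (fun p hp => ?_) hx
    have hode := deriv_profile_ode hγ n (norm_sq_pos_of_mem hp)
    rw [(hg n).laplacian_dipole _ hp]
    simp only [dipole, smul_eq_mul]
    have hs : ∑ m ∈ Finset.range n, beta κ c (n - m)
        * (2 * deriv (profile κ c m) (‖p‖ ^ 2) * ⟪p, stdVec i⟫)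
        = 2 * ⟪p, stdVec i⟫ * ∑ m ∈ Finset.range n, beta κ c (n - m)
          * deriv (profile κ c m) (‖p‖ ^ 2) := by
      rw [Finset.mul_sum]
      exact Finset.sum_congr rfl fun m _ => by ring
    rw [hs]
    linear_combination 2 * ⟪p, stdVec i⟫ * hode
  rw [InnerProductSpace.laplacian_congr_nhds he |>.eq_of_nhds, InnerProductSpace.laplacian_neg,
    Pi.neg_apply, (hsm 0).laplacian_add (hsm 1), hlap, hlap]
  simp only [fun m => (hg m).dlp_eq hz hw hx, Fin.sum_univ_two, mul_neg, mul_add, neg_add,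
    Finset.sum_add_distrib, Finset.sum_neg_distrib]
  ring

/-! ### Distances near a point of a simple closed curve -/

/-- A simple closed regular `C²` curve with a `2π`-periodic parametrization. -/
structure IsClosedCurve (z : ℝ → Plane) : Prop where
  contDiff : ContDiff ℝ 2 z
  periodic : Function.Periodic z (2 * Real.pi)
  regular : ∀ s, deriv z s ≠ 0
  injective : ∀ s ∈ Ico 0 (2 * Real.pi), ∀ t ∈ Ico 0 (2 * Real.pi), z s = z t → s = t

theorem periodic_deriv {F : Type} [NormedAddCommGroup F] [NormedSpace ℝ F] {f : ℝ → F} {T : ℝ}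
    (hf : Function.Periodic f T) : Function.Periodic (deriv f) T := fun s => by
  rw [← deriv_comp_add_const, show (fun x => f (x + T)) = f from funext hf]

theorem integral_period_eq {f : ℝ → ℝ} (hf : Function.Periodic f (2 * Real.pi)) (s₀ : ℝ) :
    ∫ s in (0 : ℝ)..(2 * Real.pi), f s = ∫ s in (s₀ - Real.pi)..(s₀ + Real.pi), f s := by
  have h := hf.intervalIntegral_add_eq 0 (s₀ - Real.pi)
  rw [zero_add, show s₀ - Real.pi + 2 * Real.pi = s₀ + Real.pi by ring] at h
  exact h

theorem exists_mem_abs_sub_le {z : ℝ → Plane} (hp : Function.Periodic z (2 * Real.pi)) (s₀ t : ℝ) :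
    ∃ s, |s - s₀| ≤ Real.pi ∧ z s = z t := by
  obtain ⟨s, hs, h⟩ := hp.exists_mem_Ico Real.two_pi_pos t (s₀ - Real.pi)
  exact ⟨s, abs_le.2 ⟨by linarith [hs.1], by linarith [hs.2]⟩, h.symm⟩

namespace IsClosedCurve

variable {z : ℝ → Plane}

theorem continuous (hz : IsClosedCurve z) : Continuous z := hz.contDiff.continuous

theorem contDiff_one (hz : IsClosedCurve z) : ContDiff ℝ 1 z := hz.contDiff.of_le (by norm_num)

theorem continuous_deriv (hz : IsClosedCurve z) : Continuous (deriv z) :=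
  hz.contDiff_one.continuous_deriv le_rfl

theorem eq_of_abs_sub_le (hz : IsClosedCurve z) {s s₀ : ℝ} (hs : |s - s₀| ≤ Real.pi)
    (h : z s = z s₀) : s = s₀ := by
  have hmod : ∀ t, z (toIcoMod Real.two_pi_pos 0 t) = z t := fun t => by
    rw [toIcoMod, hz.periodic.sub_zsmul_eq]
  have hmem : ∀ t, toIcoMod Real.two_pi_pos 0 t ∈ Ico 0 (2 * Real.pi) := fun t => by
    simpa using toIcoMod_mem_Ico Real.two_pi_pos 0 t
  have heq := hz.injective _ (hmem s) _ (hmem s₀) (by rw [hmod, hmod, h])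
  simp only [toIcoMod, zsmul_eq_mul] at heq
  set m : ℤ := toIcoDiv Real.two_pi_pos 0 s - toIcoDiv Real.two_pi_pos 0 s₀ with hm
  have hm' : s - s₀ = m * (2 * Real.pi) := by
    rw [hm]
    push_cast
    linarith
  have hpi := Real.pi_pos
  have hm0 : m = 0 := by
    by_contra hne
    have h1 : (1 : ℝ) ≤ |(m : ℝ)| := by exact_mod_cast Int.one_le_abs hne
    rw [hm', abs_mul, abs_of_pos Real.two_pi_pos] at hs
    nlinarith
  rw [hm0] at hm'
  simp at hm'
  linarith

theorem exists_local_estimate (hz : IsClosedCurve z) (s₀ : ℝ) : ∃ δ, 0 < δ ∧ ∀ s t,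
    |s - s₀| < δ → |t - s₀| < δ →
      ‖z s - z t - (s - t) • deriv z s₀‖ ≤ ‖deriv z s₀‖ / 2 * |s - t| := by
  have h : HasStrictDerivAt z (deriv z s₀) s₀ :=
    hz.contDiff.contDiffAt.hasStrictDerivAt (by norm_num)
  have hpos : 0 < ‖deriv z s₀‖ / 2 := by
    have := norm_pos_iff.2 (hz.regular s₀)
    positivity
  have h1 := h.hasStrictFDerivAt.isLittleO.def hpos
  obtain ⟨δ, hδ, h2⟩ := Metric.eventually_nhds_iff.1 h1
  refine ⟨δ, hδ, fun s t hs ht => ?_⟩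
  have := h2 (y := (s, t)) (by
    rw [Prod.dist_eq, max_lt_iff, Real.dist_eq, Real.dist_eq]
    exact ⟨hs, ht⟩)
  simpa using this

theorem exists_far_estimate (hz : IsClosedCurve z) (s₀ : ℝ) {δ : ℝ} (hδ : 0 < δ) :
    ∃ m, 0 < m ∧ ∀ s, δ ≤ |s - s₀| → |s - s₀| ≤ Real.pi → m ≤ ‖z s - z s₀‖ := by
  have hK : IsCompact (Metric.closedBall s₀ Real.pi ∩ {s | δ ≤ |s - s₀|}) :=
    (isCompact_closedBall _ _).inter_right
      (isClosed_le continuous_const (by fun_prop))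
  have hc : ContinuousOn (fun s => ‖z s - z s₀‖)
      (Metric.closedBall s₀ Real.pi ∩ {s | δ ≤ |s - s₀|}) :=
    ((hz.continuous.sub continuous_const).norm).continuousOn
  obtain ⟨m, hm, h⟩ := hK.exists_forall_le' hc (a := 0) (by
    rintro s ⟨hs, hs'⟩
    refine norm_pos_iff.2 fun h0 => ?_
    have := hz.eq_of_abs_sub_le (by simpa [Real.dist_eq] using hs) (sub_eq_zero.1 h0)
    rw [mem_ofPred_eq, this, sub_self, abs_zero] at hs'
    linarith)
  exact ⟨m, hm, fun s h1 h2 => h s ⟨by simpa [Real.dist_eq] using h2, h1⟩⟩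

/-- Chord-arc estimate between a point near `s₀` and an arbitrary point within half a period. -/
theorem exists_chord_arc (hz : IsClosedCurve z) (s₀ : ℝ) : ∃ a δ, 0 < a ∧ 0 < δ ∧ ∀ t s,
    |t - s₀| < δ → |s - s₀| ≤ Real.pi → a * |s - t| ≤ ‖z s - z t‖ := by
  obtain ⟨δ, hδ, hloc⟩ := hz.exists_local_estimate s₀
  obtain ⟨m, hm, hfar⟩ := hz.exists_far_estimate s₀ hδ
  have hd := norm_pos_iff.2 (hz.regular s₀)
  obtain ⟨δ', hδ', hclose⟩ := Metric.continuousAt_iff.1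
    (hz.continuous.continuousAt (x := s₀)) (m / 2) (by positivity)
  have hpi := Real.pi_pos
  refine ⟨min (‖deriv z s₀‖ / 2) (m / 2 / (Real.pi + δ)), min δ δ',
    lt_min (by positivity) (by positivity), lt_min hδ hδ', fun t s ht hs => ?_⟩
  have ht1 := ht.trans_le (min_le_left _ _)
  have ht2 := ht.trans_le (min_le_right _ _)
  by_cases hsδ : |s - s₀| < δ
  · have h1 := hloc s t hsδ ht1
    have h2 := norm_sub_norm_le ((s - t) • deriv z s₀) (z s - z t)
    rw [norm_sub_rev ((s - t) • deriv z s₀), norm_smul, Real.norm_eq_abs] at h2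
    have h3 : min (‖deriv z s₀‖ / 2) (m / 2 / (Real.pi + δ)) * |s - t|
        ≤ ‖deriv z s₀‖ / 2 * |s - t| := by
      gcongr
      exact min_le_left _ _
    linarith
  · have h1 := hfar s (not_lt.1 hsδ) hs
    have h2 : ‖z t - z s₀‖ < m / 2 := by
      simpa [dist_eq_norm, Real.dist_eq] using hclose (x := t) (by simpa [Real.dist_eq] using ht2)
    have h3 : ‖z s - z s₀‖ ≤ ‖z s - z t‖ + ‖z t - z s₀‖ := by
      simpa using norm_add_le (z s - z t) (z t - z s₀)
    have h4 : |s - t| ≤ Real.pi + δ := by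
      have : |s - t| ≤ |s - s₀| + |t - s₀| := by
        rw [abs_sub_comm t s₀]
        simpa using abs_add_le (s - s₀) (s₀ - t)
      linarith
    calc _ ≤ m / 2 / (Real.pi + δ) * (Real.pi + δ) := by
          gcongr
          exact min_le_right _ _
      _ = m / 2 := by field_simp
      _ ≤ _ := by linarith

end IsClosedCurve

/-- The unit tangent of `z` at `s`. -/
def tangent (z : ℝ → Plane) (s : ℝ) : Plane := ‖deriv z s‖⁻¹ • deriv z s

theorem normal_eq (z : ℝ → Plane) (s : ℝ) : normal z s = ‖deriv z s‖⁻¹ • nvec z s := rfl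

theorem inner_plane (p q : Plane) : ⟪p, q⟫ = p 0 * q 0 + p 1 * q 1 := by
  simp [PiLp.inner_apply, mul_comm]

theorem norm_sq_plane (p : Plane) : ‖p‖ ^ 2 = p 0 ^ 2 + p 1 ^ 2 := by
  rw [← real_inner_self_eq_norm_sq, inner_plane]
  ring

theorem nvec_zero (z : ℝ → Plane) (s : ℝ) : nvec z s 0 = deriv z s 1 := rfl

theorem nvec_one (z : ℝ → Plane) (s : ℝ) : nvec z s 1 = -(deriv z s 0) := rfl

theorem norm_nvec (z : ℝ → Plane) (s : ℝ) : ‖nvec z s‖ = ‖deriv z s‖ := by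
  rw [← sq_eq_sq₀ (norm_nonneg _) (norm_nonneg _), norm_sq_plane, norm_sq_plane, nvec_zero,
    nvec_one]
  ring

theorem inner_normal_tangent (z : ℝ → Plane) (s : ℝ) : ⟪normal z s, tangent z s⟫ = 0 := by
  rw [normal_eq, tangent, inner_smul_left, inner_smul_right, inner_plane, nvec_zero, nvec_one]
  ring

namespace IsClosedCurve

variable {z : ℝ → Plane}

theorem norm_tangent (hz : IsClosedCurve z) (s : ℝ) : ‖tangent z s‖ = 1 := by
  rw [tangent, norm_smul, norm_inv, norm_norm]
  exact inv_mul_cancel₀ (norm_ne_zero_iff.2 (hz.regular s))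

theorem norm_normal (hz : IsClosedCurve z) (s : ℝ) : ‖normal z s‖ = 1 := by
  rw [normal_eq, norm_smul, norm_inv, norm_norm, norm_nvec]
  exact inv_mul_cancel₀ (norm_ne_zero_iff.2 (hz.regular s))

/-- Points on the normal line approach the curve non-tangentially. -/
theorem exists_normal_estimate (hz : IsClosedCurve z) (s₀ : ℝ) :
    ∃ a η : ℝ, 0 < a ∧ 0 < η ∧ ∀ h s : ℝ, |h| < η → |s - s₀| ≤ Real.pi →
      a * |s - s₀| ≤ ‖z s₀ + h • normal z s₀ - z s‖ := by
  obtain ⟨δ, hδ, hloc⟩ := hz.exists_local_estimate s₀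
  obtain ⟨m, hm, hfar⟩ := hz.exists_far_estimate s₀ hδ
  have hd := norm_pos_iff.2 (hz.regular s₀)
  have hpi := Real.pi_pos
  refine ⟨min (‖deriv z s₀‖ / 2) (m / 2 / Real.pi), m / 2, lt_min (by positivity) (by positivity),
    by positivity, fun h s hh hs => ?_⟩
  by_cases hsδ : |s - s₀| < δ
  · have h1 := hloc s s₀ hsδ (by simpa using hδ)
    -- The component along the tangent does not see `h`.
    have h2 : ⟪z s₀ + h • normal z s₀ - z s, tangent z s₀⟫
        = -(⟪z s - z s₀ - (s - s₀) • deriv z s₀, tangent z s₀⟫ + (s - s₀) * ‖deriv z s₀‖) := by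
      have h3 : ⟪deriv z s₀, tangent z s₀⟫ = ‖deriv z s₀‖ := by
        rw [tangent, inner_smul_right, real_inner_self_eq_norm_sq]
        field_simp
      simp only [inner_sub_left, inner_add_left, inner_smul_left, inner_normal_tangent, h3,
        conj_trivial]
      ring
    have h4 : |⟪z s₀ + h • normal z s₀ - z s, tangent z s₀⟫| ≤ ‖z s₀ + h • normal z s₀ - z s‖ := by
      simpa [hz.norm_tangent] using abs_real_inner_le_norm (z s₀ + h • normal z s₀ - z s)
        (tangent z s₀)
    have h5 : |⟪z s - z s₀ - (s - s₀) • deriv z s₀, tangent z s₀⟫|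
        ≤ ‖deriv z s₀‖ / 2 * |s - s₀| := by
      have := abs_real_inner_le_norm (z s - z s₀ - (s - s₀) • deriv z s₀) (tangent z s₀)
      rw [hz.norm_tangent, mul_one] at this
      exact this.trans h1
    have h6 : |s - s₀| * ‖deriv z s₀‖ - ‖deriv z s₀‖ / 2 * |s - s₀|
        ≤ |⟪z s₀ + h • normal z s₀ - z s, tangent z s₀⟫| := by
      rw [h2, abs_neg]
      have h7 := abs_sub_abs_le_abs_sub ((s - s₀) * ‖deriv z s₀‖)
        (-⟪z s - z s₀ - (s - s₀) • deriv z s₀, tangent z s₀⟫)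
      rw [abs_neg, sub_neg_eq_add, abs_mul, abs_norm, add_comm _ ⟪_, _⟫] at h7
      linarith
    have h8 : min (‖deriv z s₀‖ / 2) (m / 2 / Real.pi) * |s - s₀|
        ≤ ‖deriv z s₀‖ / 2 * |s - s₀| := by
      gcongr
      exact min_le_left _ _
    linarith
  · have h1 := hfar s (not_lt.1 hsδ) hs
    have h2 : ‖z s - z s₀‖ ≤ ‖z s₀ + h • normal z s₀ - z s‖ + |h| := by
      have := norm_sub_le (h • normal z s₀) (z s₀ + h • normal z s₀ - z s)
      rw [norm_smul, hz.norm_normal, mul_one, Real.norm_eq_abs] at this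
      rw [show z s - z s₀ = h • normal z s₀ - (z s₀ + h • normal z s₀ - z s) by abel]
      linarith
    calc _ ≤ m / 2 / Real.pi * Real.pi := by
          gcongr
          exact min_le_right _ _
      _ = m / 2 := by field_simp
      _ ≤ _ := by linarith

theorem eventually_notMem_range (hz : IsClosedCurve z) (s₀ : ℝ) :
    ∀ᶠ h in 𝓝[≠] (0 : ℝ), z s₀ + h • normal z s₀ ∉ range z := by
  obtain ⟨a, η, ha, hη, hest⟩ := hz.exists_normal_estimate s₀
  have h0 : ∀ᶠ h in 𝓝[≠] (0 : ℝ), |h| < η :=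
    eventually_nhdsWithin_of_eventually_nhds
      ((continuous_abs.tendsto' 0 0 abs_zero).eventually (gt_mem_nhds hη))
  filter_upwards [h0, self_mem_nhdsWithin] with h hh hne
  rintro ⟨t, ht⟩
  obtain ⟨s, hs, hst⟩ := exists_mem_abs_sub_le hz.periodic s₀ t
  have h1 := hest h s hh hs
  rw [hst, ht, sub_self, norm_zero] at h1
  have h2 : s = s₀ := by
    have : |s - s₀| ≤ 0 := by nlinarith [abs_nonneg (s - s₀)]
    exact sub_eq_zero.1 (abs_nonpos_iff.1 this)
  have h3 : h • normal z s₀ = 0 := by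
    have : z s₀ + h • normal z s₀ = z s₀ := by rw [← ht, ← hst, h2]
    simpa using this
  have h4 := hz.norm_normal s₀
  rcases smul_eq_zero.1 h3 with h5 | h5
  · exact hne h5
  · rw [h5, norm_zero] at h4
    exact zero_ne_one h4

end IsClosedCurve

/-! ### The gradient of a double-layer potential -/

/-- Rotation by a right angle, counterclockwise. -/
def quarterTurn (e : Plane) : Plane := !₂[-(e 1), e 0]

theorem quarterTurn_normal (z : ℝ → Plane) (s : ℝ) : quarterTurn (normal z s) = tangent z s := by
  ext i
  fin_cases i <;> simp [quarterTurn, normal, tangent]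

/-- What remains of `dipole g v` when the dipole of `-log |p|` is removed. -/
def regDipole (g : ℝ → ℝ) (v p : Plane) : ℝ :=
  2 * (deriv g (‖p‖ ^ 2) + 1 / (2 * ‖p‖ ^ 2)) * ⟪p, v⟫

/-- What remains of `dipoleDeriv g v e` when the contribution of `-log |p|` is removed. -/
def regDipoleDeriv (g : ℝ → ℝ) (v e p : Plane) : ℝ :=
  4 * (deriv (deriv g) (‖p‖ ^ 2) - 1 / (2 * (‖p‖ ^ 2) ^ 2)) * ⟪p, e⟫ * ⟪p, v⟫
    + 2 * (deriv g (‖p‖ ^ 2) + 1 / (2 * ‖p‖ ^ 2)) * ⟪e, v⟫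

theorem dipole_eq_reg (g : ℝ → ℝ) (v p : Plane) :
    dipole g v p = regDipole g v p - ⟪p, v⟫ / ‖p‖ ^ 2 := by
  rw [dipole, regDipole]
  field_simp
  ring

theorem dipoleDeriv_eq_reg (g : ℝ → ℝ) (v e p : Plane) :
    dipoleDeriv g v e p = regDipoleDeriv g v e p
      + (2 * ⟪p, e⟫ * ⟪p, v⟫ / (‖p‖ ^ 2) ^ 2 - ⟪e, v⟫ / ‖p‖ ^ 2) := by
  rw [dipoleDeriv, regDipoleDeriv]
  ring

theorem deriv_log_profile {ρ : ℝ} (hρ : 0 < ρ) :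
    deriv (fun ρ => -(Real.log ρ / 2)) ρ = -(1 / (2 * ρ)) := by
  have := (hasDerivAt_log_half hρ 0).neg.deriv
  simpa using this

theorem deriv2_log_profile {ρ : ℝ} (hρ : 0 < ρ) :
    deriv (deriv fun ρ => -(Real.log ρ / 2)) ρ = 1 / (2 * ρ ^ 2) := by
  have he : (deriv fun ρ => -(Real.log ρ / 2)) =ᶠ[𝓝 ρ] fun ρ => -(1 / 2 * ρ⁻¹) := by
    filter_upwards [lt_mem_nhds hρ] with x hx
    rw [deriv_log_profile hx]
    field_simp
  rw [he.deriv_eq, ((hasDerivAt_inv hρ.ne').const_mul (1 / 2 : ℝ)).fun_neg.deriv]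
  field_simp

section regular

variable {g : ℝ → ℝ} {z : ℝ → Plane} {w : ℝ → ℝ} {x : Plane}

theorem norm_sub_sq_pos (hx : x ∉ range z) (s : ℝ) : 0 < ‖x - z s‖ ^ 2 :=
  norm_sq_pos_of_mem (sub_mem_compl_zero hx s)

theorem continuous_comp_norm_sq {G : ℝ → ℝ} (hG : ContinuousOn G (Ioi 0)) (hz : Continuous z)
    (hx : x ∉ range z) : Continuous fun s => G (‖x - z s‖ ^ 2) :=
  hG.comp_continuous (by fun_prop) fun s => norm_sub_sq_pos hx s

theorem continuousOn_regDeriv (hg : IsLogProfile g) :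
    ContinuousOn (fun ρ => deriv g ρ + 1 / (2 * ρ)) (Ioi 0) := by
  refine hg.contDiffOn_deriv.continuousOn.add (continuousOn_const.div (by fun_prop) ?_)
  intro ρ hρ
  have : 0 < ρ := hρ
  positivity

theorem continuousOn_regDeriv2 (hg : IsLogProfile g) :
    ContinuousOn (fun ρ => deriv (deriv g) ρ - 1 / (2 * ρ ^ 2)) (Ioi 0) := by
  refine hg.contDiffOn_deriv2.continuousOn.sub (continuousOn_const.div (by fun_prop) ?_)
  intro ρ hρ
  have : 0 < ρ := hρ
  positivity

theorem continuous_regDipole (hg : IsLogProfile g) (hz : ContDiff ℝ 1 z) (hx : x ∉ range z) :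
    Continuous fun s => regDipole g (nvec z s) (x - z s) := by
  have h1 := continuous_comp_norm_sq (continuousOn_regDeriv hg) hz.continuous hx
  have h3 := continuous_nvec hz
  have h4 := hz.continuous
  exact (continuous_const.mul h1).mul ((continuous_const.sub h4).inner h3)

theorem continuous_regDipoleDeriv (hg : IsLogProfile g) (hz : ContDiff ℝ 1 z) (hx : x ∉ range z)
    (e : Plane) : Continuous fun s => regDipoleDeriv g (nvec z s) e (x - z s) := by
  have h1 := continuous_comp_norm_sq (continuousOn_regDeriv hg) hz.continuous hx
  have h2 := continuous_comp_norm_sq (continuousOn_regDeriv2 hg) hz.continuous hx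
  have h3 := continuous_nvec hz
  have h4 := hz.continuous
  exact (((continuous_const.mul h2).mul ((continuous_const.sub h4).inner continuous_const)).mul
    ((continuous_const.sub h4).inner h3)).add
    ((continuous_const.mul h1).mul (continuous_const.inner h3))

theorem continuous_inner_div (hz : Continuous z) {v : ℝ → Plane} (hv : Continuous v)
    (hx : x ∉ range z) : Continuous fun s => ⟪x - z s, v s⟫ / ‖x - z s‖ ^ 2 :=
  ((continuous_const.sub hz).inner hv).div (by fun_prop) fun s => (norm_sub_sq_pos hx s).ne'

/-- The kernel `∂_e ∂_N log |x - z(s)|` is a derivative along the curve, because the gradient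
`p / |p|²` of `log |p|` is free of divergence and curl. -/
theorem hasDerivAt_conjugate_kernel (hz : ContDiff ℝ 1 z) (hx : x ∉ range z) (e : Plane) (s : ℝ) :
    HasDerivAt (fun s => ⟪x - z s, quarterTurn e⟫ / ‖x - z s‖ ^ 2)
      (-(2 * ⟪x - z s, e⟫ * ⟪x - z s, nvec z s⟫ / (‖x - z s‖ ^ 2) ^ 2
        - ⟪e, nvec z s⟫ / ‖x - z s‖ ^ 2)) s := by
  have hd : HasDerivAt (fun s => x - z s) (-(deriv z s)) s :=
    (hz.differentiable (by norm_num) s).hasDerivAt.const_sub x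
  have h := (hd.inner ℝ (hasDerivAt_const s (quarterTurn e))).div hd.norm_sq
    (norm_sub_sq_pos hx s).ne'
  refine h.congr_deriv ?_
  have hpos := (norm_sub_sq_pos hx s).ne'
  have hsq := norm_sq_plane (x - z s)
  set p := x - z s with hp
  simp only [inner_zero_right, inner_neg_left, inner_neg_right, zero_add]
  field_simp
  rw [hsq]
  simp only [inner_plane, nvec_zero, nvec_one]
  simp only [quarterTurn, Matrix.cons_val_zero, Matrix.cons_val_one]
  ring

/-- The gradient of a double-layer potential: integration by parts moves one derivative of the
logarithmic part from the kernel to the density. -/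
theorem IsLogProfile.fderiv_dlp_eq (hg : IsLogProfile g) (hz : ContDiff ℝ 1 z)
    (hp : Function.Periodic z (2 * Real.pi)) (hw : ContDiff ℝ 1 w)
    (hwp : Function.Periodic w (2 * Real.pi)) (hx : x ∉ range z) (e : Plane) :
    fderiv ℝ (dlp g z w) x e
      = -(∫ s in (0 : ℝ)..(2 * Real.pi),
          deriv w s * (⟪x - z s, quarterTurn e⟫ / ‖x - z s‖ ^ 2))
        - ∫ s in (0 : ℝ)..(2 * Real.pi), w s * regDipoleDeriv g (nvec z s) e (x - z s) := by
  have hkc : Continuous fun s => -(2 * ⟪x - z s, e⟫ * ⟪x - z s, nvec z s⟫ / (‖x - z s‖ ^ 2) ^ 2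
        - ⟪e, nvec z s⟫ / ‖x - z s‖ ^ 2) := by
    have h3 := continuous_nvec hz
    have h4 := hz.continuous
    refine Continuous.neg (Continuous.sub (Continuous.div ?_ (by fun_prop) fun s => ?_)
      (Continuous.div (continuous_const.inner h3) (by fun_prop) fun s => ?_))
    · exact (continuous_const.mul ((continuous_const.sub h4).inner continuous_const)).mul
        ((continuous_const.sub h4).inner h3)
    · have := norm_sub_sq_pos hx s
      positivity
    · exact (norm_sub_sq_pos hx s).ne'
  have hparts := intervalIntegral.integral_mul_deriv_eq_deriv_mul (a := 0) (b := 2 * Real.pi)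
    (fun s _ => (hw.differentiable (by norm_num) s).hasDerivAt)
    (fun s _ => hasDerivAt_conjugate_kernel hz hx e s)
    ((hw.continuous_deriv le_rfl).intervalIntegrable _ _) (hkc.intervalIntegrable _ _)
  have hw0 : w (2 * Real.pi) = w 0 := by simpa using hwp 0
  have hz0 : z (2 * Real.pi) = z 0 := by simpa using hp 0
  rw [hw0, hz0, sub_self, zero_sub] at hparts
  rw [hg.fderiv_dlp hz hp hw.continuous hx, ← hparts, ← intervalIntegral.integral_sub
    ((hw.continuous.fun_mul hkc).intervalIntegrable _ _)
    ((hw.continuous.fun_mul (continuous_regDipoleDeriv hg hz hx e)).intervalIntegrable _ _),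
    ← intervalIntegral.integral_neg]
  refine intervalIntegral.integral_congr fun s _ => ?_
  simp only [dipoleDeriv_eq_reg]
  ring

/-- The double-layer potential with density `1` for the logarithmic kernel is constant on
connected open sets that do not meet the curve. -/
theorem dlp_log_one_const (hz : ContDiff ℝ 1 z) (hp : Function.Periodic z (2 * Real.pi))
    {Ω : Set Plane} (hΩ : IsOpen Ω) (hc : IsPreconnected Ω) (hd : Disjoint Ω (range z)) :
    ∃ b, ∀ x ∈ Ω, dlp (fun ρ => -(Real.log ρ / 2)) z (fun _ => 1) x = b := by
  have hsub : Ω ⊆ (range z)ᶜ := hd.subset_compl_right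
  refine hΩ.exists_is_const_of_fderiv_eq_zero (𝕜 := ℝ) hc
    (((isLogProfile_log.contDiffOn_dlp hz hp continuous_const 1).differentiableOn
      (by norm_num)).mono hsub) fun x hx => ?_
  ext e
  rw [isLogProfile_log.fderiv_dlp_eq hz hp contDiff_const (fun _ => rfl) (hsub hx)]
  have h0 : ∀ s, regDipoleDeriv (fun ρ => -(Real.log ρ / 2)) (nvec z s) e (x - z s) = 0 := by
    intro s
    have hpos := norm_sub_sq_pos (hsub hx) s
    rw [regDipoleDeriv, deriv_log_profile hpos, deriv2_log_profile hpos]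
    ring
  simp [h0]

theorem dlp_log_one_eq (hx : x ∉ range z) :
    dlp (fun ρ => -(Real.log ρ / 2)) z (fun _ => 1) x
      = ∫ s in (0 : ℝ)..(2 * Real.pi), ⟪x - z s, nvec z s⟫ / ‖x - z s‖ ^ 2 := by
  rw [dlp, ← intervalIntegral.integral_neg]
  refine intervalIntegral.integral_congr fun s _ => ?_
  have hpos := norm_sub_sq_pos hx s
  simp only [dipole, deriv_log_profile hpos]
  field_simp

theorem integral_inner_deriv_div (hz : ContDiff ℝ 1 z) (hp : Function.Periodic z (2 * Real.pi))
    (hx : x ∉ range z) :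
    ∫ s in (0 : ℝ)..(2 * Real.pi), ⟪x - z s, deriv z s⟫ / ‖x - z s‖ ^ 2 = 0 := by
  have hd : ∀ s, HasDerivAt (fun s => -(Real.log (‖x - z s‖ ^ 2) / 2))
      (⟪x - z s, deriv z s⟫ / ‖x - z s‖ ^ 2) s := fun s => by
    have hd1 : HasDerivAt (fun s => x - z s) (-(deriv z s)) s :=
      (hz.differentiable (by norm_num) s).hasDerivAt.const_sub x
    refine ((hd1.norm_sq.log (norm_sub_sq_pos hx s).ne').div_const 2).neg.congr_deriv ?_
    rw [inner_neg_right]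
    field_simp
  rw [intervalIntegral.integral_eq_sub_of_hasDerivAt (fun s _ => hd s)
    ((continuous_inner_div hz.continuous (hz.continuous_deriv le_rfl) hx).intervalIntegrable _ _)]
  have hz0 : z (2 * Real.pi) = z 0 := by simpa using hp 0
  rw [hz0, sub_self]

/-- The regular parts of the kernels are weakly singular. -/
theorem IsLogProfile.exists_reg_bounds (hg : IsLogProfile g) (R : ℝ) :
    ∃ C, 0 ≤ C ∧ ∀ p : Plane, p ≠ 0 → ‖p‖ ≤ R → ∀ v e,
      |regDipole g v p| ≤ C * ‖v‖ ∧
      |regDipoleDeriv g v e p| ≤ C * ‖v‖ * ‖e‖ * ‖p‖ ^ (-(1 / 2) : ℝ) := by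
  obtain ⟨C, hC, hb⟩ := hg.bounds (R ^ 2)
  refine ⟨6 * C + 2 * C * |R| ^ (1 / 2 : ℝ), by positivity, fun p hp hpR v e => ?_⟩
  have hpos : 0 < ‖p‖ := norm_pos_iff.2 hp
  have hR : 0 < R := hpos.trans_le hpR
  obtain ⟨h1, h2⟩ := hb (‖p‖ ^ 2) (by positivity) (by gcongr)
  have hpow : (‖p‖ ^ 2) ^ (-(1 / 4) : ℝ) = ‖p‖ ^ (-(1 / 2) : ℝ) := by
    rw [← Real.rpow_natCast, ← Real.rpow_mul hpos.le]
    norm_num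
  rw [hpow] at h1 h2
  have hpv := abs_real_inner_le_norm p v
  have hpe := abs_real_inner_le_norm p e
  have hev := abs_real_inner_le_norm e v
  have hy : 0 < ‖p‖ ^ (-(1 / 2) : ℝ) := Real.rpow_pos_of_pos hpos _
  have hyp : ‖p‖ ^ (-(1 / 2) : ℝ) * ‖p‖ ≤ |R| ^ (1 / 2 : ℝ) := by
    rw [abs_of_pos hR, ← Real.rpow_add_one hpos.ne']
    norm_num
    exact Real.rpow_le_rpow hpos.le hpR (by norm_num)
  set y := ‖p‖ ^ (-(1 / 2) : ℝ)
  have hRn : 0 ≤ |R| ^ (1 / 2 : ℝ) := by positivity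
  constructor
  · rw [regDipole, abs_mul, abs_mul, abs_two]
    calc 2 * |deriv g (‖p‖ ^ 2) + 1 / (2 * ‖p‖ ^ 2)| * |⟪p, v⟫|
        ≤ 2 * (C * y) * (‖p‖ * ‖v‖) := by gcongr
      _ = 2 * C * (y * ‖p‖) * ‖v‖ := by ring
      _ ≤ 2 * C * |R| ^ (1 / 2 : ℝ) * ‖v‖ := by gcongr
      _ ≤ _ := by
        gcongr
        linarith
  · rw [regDipoleDeriv]
    refine (abs_add_le _ _).trans ?_
    rw [abs_mul, abs_mul, abs_mul, abs_mul, abs_mul, abs_two, abs_of_pos (by norm_num : (0:ℝ) < 4)]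
    calc 4 * |deriv (deriv g) (‖p‖ ^ 2) - 1 / (2 * (‖p‖ ^ 2) ^ 2)| * |⟪p, e⟫| * |⟪p, v⟫|
          + 2 * |deriv g (‖p‖ ^ 2) + 1 / (2 * ‖p‖ ^ 2)| * |⟪e, v⟫|
        ≤ 4 * |deriv (deriv g) (‖p‖ ^ 2) - 1 / (2 * (‖p‖ ^ 2) ^ 2)| * (‖p‖ * ‖e‖) * (‖p‖ * ‖v‖)
          + 2 * (C * y) * (‖e‖ * ‖v‖) := by gcongr
      _ = 4 * (|deriv (deriv g) (‖p‖ ^ 2) - 1 / (2 * (‖p‖ ^ 2) ^ 2)| * ‖p‖ ^ 2) * (‖e‖ * ‖v‖)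
          + 2 * (C * y) * (‖e‖ * ‖v‖) := by ring
      _ ≤ 4 * (C * y) * (‖e‖ * ‖v‖) + 2 * (C * y) * (‖e‖ * ‖v‖) := by gcongr
      _ = 6 * C * ‖v‖ * ‖e‖ * y := by ring
      _ ≤ _ := by
        gcongr
        have : 0 ≤ 2 * C * |R| ^ (1 / 2 : ℝ) := by positivity
        linarith

end regular

/-! ### Boundary behaviour of double-layer potentials -/

/-- Dominated convergence on one period around `s₀`, with conditions only off `s₀`. -/
theorem tendsto_integral_punctured {ι : Type} {l : Filter ι} [l.IsCountablyGenerated]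
    {F : ι → ℝ → ℝ} {f bound : ℝ → ℝ} (s₀ : ℝ) (hc : ∀ᶠ i in l, Continuous (F i))
    (hb : ∀ᶠ i in l, ∀ s, |s - s₀| ≤ Real.pi → s ≠ s₀ → |F i s| ≤ bound s)
    (hi : IntervalIntegrable bound MeasureTheory.volume (s₀ - Real.pi) (s₀ + Real.pi))
    (hlim : ∀ s, |s - s₀| ≤ Real.pi → s ≠ s₀ → Tendsto (fun i => F i s) l (𝓝 (f s))) :
    Tendsto (fun i => ∫ s in (s₀ - Real.pi)..(s₀ + Real.pi), F i s) l
      (𝓝 (∫ s in (s₀ - Real.pi)..(s₀ + Real.pi), f s)) := by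
  have hae : ∀ᵐ s ∂(MeasureTheory.volume : MeasureTheory.Measure ℝ), s ≠ s₀ :=
    (countable_singleton s₀).ae_notMem _
  have hmem : ∀ s ∈ uIoc (s₀ - Real.pi) (s₀ + Real.pi), |s - s₀| ≤ Real.pi := fun s hs => by
    rw [uIoc_of_le (by linarith [Real.pi_pos])] at hs
    exact abs_le.2 ⟨by linarith [hs.1], by linarith [hs.2]⟩
  refine intervalIntegral.tendsto_integral_filter_of_dominated_convergence bound ?_ ?_ hi ?_
  · filter_upwards [hc] with i h using h.aestronglyMeasurable
  · filter_upwards [hb] with i h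
    filter_upwards [hae] with s hs hs' using h s (hmem s hs') hs
  · filter_upwards [hae] with s hs hs' using hlim s (hmem s hs') hs

theorem intervalIntegrable_abs_rpow {r : ℝ} (hr : -1 < r) (s₀ a b : ℝ) :
    IntervalIntegrable (fun s => |s - s₀| ^ r) MeasureTheory.volume a b := by
  have h0 : ∀ u v : ℝ, IntervalIntegrable (fun s => |s| ^ r) MeasureTheory.volume u v := by
    refine fun u v => intervalIntegrable_of_even (fun x => by rw [abs_neg]) fun x hx => ?_
    refine (intervalIntegral.intervalIntegrable_rpow' hr).congr fun y hy => ?_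
    rw [uIoc_of_le hx.le] at hy
    simp only [abs_of_pos hy.1]
  simpa using (h0 (a - s₀) (b - s₀)).comp_sub_right s₀

theorem exists_lipschitz_bound {F : Type} [NormedAddCommGroup F] [NormedSpace ℝ F] {f : ℝ → F}
    (hf : ContDiff ℝ 1 f) (a b : ℝ) :
    ∃ K, 0 ≤ K ∧ ∀ s ∈ Icc a b, ∀ t ∈ Icc a b, ‖f s - f t‖ ≤ K * |s - t| := by
  obtain ⟨K, hK⟩ := isCompact_Icc.exists_bound_of_continuousOn (s := Icc a b)
    (hf.continuous_deriv le_rfl).continuousOn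
  refine ⟨|K|, abs_nonneg K, fun s hs t ht => ?_⟩
  exact (convex_Icc a b).norm_image_sub_le_of_norm_deriv_le
    (fun x _ => hf.differentiable (by norm_num) x)
    (fun x hx => (hK x hx).trans (le_abs_self K)) ht hs

theorem continuousAt_inner_div (v : Plane) {p : Plane} (hp : p ≠ 0) :
    ContinuousAt (fun p : Plane => ⟪p, v⟫ / ‖p‖ ^ 2) p :=
  ContinuousAt.div (by fun_prop) (by fun_prop) (by positivity)

theorem IsLogProfile.continuousAt_regDipole {g : ℝ → ℝ} (hg : IsLogProfile g) (v : Plane)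
    {p : Plane} (hp : p ≠ 0) : ContinuousAt (regDipole g v) p := by
  have hpos : 0 < ‖p‖ ^ 2 := by positivity
  have h1 : ContinuousAt (fun p : Plane => deriv g (‖p‖ ^ 2) + 1 / (2 * ‖p‖ ^ 2)) p :=
    ContinuousAt.comp (f := fun p : Plane => ‖p‖ ^ 2) (g := fun ρ => deriv g ρ + 1 / (2 * ρ))
      ((continuousOn_regDeriv hg).continuousAt (Ioi_mem_nhds hpos)) (by fun_prop)
  exact (continuousAt_const.mul h1).mul (by fun_prop)

theorem IsLogProfile.continuousAt_regDipoleDeriv {g : ℝ → ℝ} (hg : IsLogProfile g) (v e : Plane)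
    {p : Plane} (hp : p ≠ 0) : ContinuousAt (regDipoleDeriv g v e) p := by
  have hpos : 0 < ‖p‖ ^ 2 := by positivity
  have h1 : ContinuousAt (fun p : Plane => deriv g (‖p‖ ^ 2) + 1 / (2 * ‖p‖ ^ 2)) p :=
    ContinuousAt.comp (f := fun p : Plane => ‖p‖ ^ 2) (g := fun ρ => deriv g ρ + 1 / (2 * ρ))
      ((continuousOn_regDeriv hg).continuousAt (Ioi_mem_nhds hpos)) (by fun_prop)
  have h2 : ContinuousAt
      (fun p : Plane => deriv (deriv g) (‖p‖ ^ 2) - 1 / (2 * (‖p‖ ^ 2) ^ 2)) p :=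
    ContinuousAt.comp (f := fun p : Plane => ‖p‖ ^ 2)
      (g := fun ρ => deriv (deriv g) ρ - 1 / (2 * ρ ^ 2))
      ((continuousOn_regDeriv2 hg).continuousAt (Ioi_mem_nhds hpos)) (by fun_prop)
  exact (((continuousAt_const.mul h2).mul (by fun_prop)).mul (by fun_prop)).add
    ((continuousAt_const.mul h1).mul continuousAt_const)

theorem periodic_nvec {z : ℝ → Plane} (hp : Function.Periodic z (2 * Real.pi)) :
    Function.Periodic (nvec z) (2 * Real.pi) := fun s => by
  rw [nvec, nvec, periodic_deriv hp s]

theorem abs_inner_div_le (p v : Plane) : |⟪p, v⟫ / ‖p‖ ^ 2| ≤ ‖v‖ / ‖p‖ := by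
  rcases eq_or_ne p 0 with rfl | hp
  · simp
  have hpos : 0 < ‖p‖ := norm_pos_iff.2 hp
  rw [abs_div, abs_of_pos (by positivity : 0 < ‖p‖ ^ 2), div_le_div_iff₀ (by positivity) hpos]
  nlinarith [abs_real_inner_le_norm p v]

section boundary

variable {g : ℝ → ℝ} {z : ℝ → Plane} {w : ℝ → ℝ}

/-- The part of the normal derivative coming from the logarithm has a limit at the boundary:
since `∫ ⟪x - z, z'⟫ / |x - z|² ds = 0`, a multiple of `z'` may be subtracted from `w' τ` so that
the difference vanishes at `s₀` with Hölder rate. -/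
theorem IsClosedCurve.exists_tendsto_log_part (hz : IsClosedCurve z) (hw : ContDiff ℝ 1 w)
    (hwp : Function.Periodic w (2 * Real.pi)) {α C : ℝ≥0} (hα : 0 < α)
    (hH : HolderWith C α (deriv w)) (s₀ : ℝ) :
    ∃ L, Tendsto (fun h : ℝ => ∫ s in (0 : ℝ)..(2 * Real.pi), deriv w s *
      (⟪z s₀ + h • normal z s₀ - z s, tangent z s₀⟫ / ‖z s₀ + h • normal z s₀ - z s‖ ^ 2))
      (𝓝[≠] 0) (𝓝 L) := by
  obtain ⟨a, η, ha, hη, hest⟩ := hz.exists_normal_estimate s₀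
  obtain ⟨K, hK, hlip⟩ := exists_lipschitz_bound
    (hz.contDiff.deriv' : ContDiff ℝ 1 (deriv z)) (s₀ - Real.pi) (s₀ + Real.pi)
  -- The density `b = w' τ - k z'` vanishes at `s₀`.
  set k : ℝ := deriv w s₀ / ‖deriv z s₀‖ with hk
  set b : ℝ → Plane := fun s => deriv w s • tangent z s₀ - k • deriv z s with hb
  have hwc : Continuous (deriv w) := hw.continuous_deriv le_rfl
  have hbc : Continuous b := (hwc.smul continuous_const).sub (hz.continuous_deriv.const_smul k)
  have hbp : Function.Periodic b (2 * Real.pi) := fun s => by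
    simp only [hb, periodic_deriv hwp s, periodic_deriv hz.periodic s]
  have hpi := Real.pi_pos
  have hbb : ∀ s, |s - s₀| ≤ Real.pi → ‖b s‖ ≤ C * |s - s₀| ^ (α : ℝ) + |k| * K * |s - s₀| := by
    intro s hs
    have hs' := abs_le.1 hs
    have e : b s = (deriv w s - deriv w s₀) • tangent z s₀ - k • (deriv z s - deriv z s₀) := by
      have : k • deriv z s₀ = deriv w s₀ • tangent z s₀ := by
        rw [tangent, smul_smul, hk, div_eq_mul_inv]
      rw [sub_smul, smul_sub, this]
      simp only [hb]
      abel
    rw [e]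
    refine (norm_sub_le _ _).trans (add_le_add ?_ ?_)
    · rw [norm_smul, hz.norm_tangent, mul_one]
      simpa [Real.dist_eq] using hH.dist_le s s₀
    · rw [norm_smul, Real.norm_eq_abs, mul_assoc]
      gcongr
      exact hlip s ⟨by linarith, by linarith⟩ s₀ ⟨by linarith, by linarith⟩
  have heq : ∀ᶠ h in 𝓝[≠] (0 : ℝ), ∫ s in (s₀ - Real.pi)..(s₀ + Real.pi),
      ⟪z s₀ + h • normal z s₀ - z s, b s⟫ / ‖z s₀ + h • normal z s₀ - z s‖ ^ 2
      = ∫ s in (0 : ℝ)..(2 * Real.pi), deriv w s * (⟪z s₀ + h • normal z s₀ - z s, tangent z s₀⟫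
        / ‖z s₀ + h • normal z s₀ - z s‖ ^ 2) := by
    filter_upwards [hz.eventually_notMem_range s₀] with h hx
    set x := z s₀ + h • normal z s₀
    have h1 := continuous_inner_div hz.continuous (continuous_const (y := tangent z s₀)) hx
    have h2 := continuous_inner_div hz.continuous hz.continuous_deriv hx
    have hsub : ∫ s in (0 : ℝ)..(2 * Real.pi), deriv w s * (⟪x - z s, tangent z s₀⟫
          / ‖x - z s‖ ^ 2)
        = (∫ s in (0 : ℝ)..(2 * Real.pi), deriv w s * (⟪x - z s, tangent z s₀⟫ / ‖x - z s‖ ^ 2))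
          - k * ∫ s in (0 : ℝ)..(2 * Real.pi), ⟪x - z s, deriv z s⟫ / ‖x - z s‖ ^ 2 := by
      rw [integral_inner_deriv_div hz.contDiff_one hz.periodic hx, mul_zero, sub_zero]
    rw [← integral_period_eq (fun s => by simp only [hz.periodic s, hbp s]) s₀, hsub,
      ← intervalIntegral.integral_const_mul, ← intervalIntegral.integral_sub
        ((hwc.fun_mul h1).intervalIntegrable _ _)
        ((continuous_const.fun_mul h2).intervalIntegrable _ _)]
    refine intervalIntegral.integral_congr fun s _ => ?_
    simp only [hb, inner_sub_right, inner_smul_right]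
    ring
  refine ⟨_, Tendsto.congr' heq (tendsto_integral_punctured
    (f := fun s => ⟪z s₀ - z s, b s⟫ / ‖z s₀ - z s‖ ^ 2)
    (bound := fun s => C / a * |s - s₀| ^ ((α : ℝ) - 1) + |k| * K / a) s₀ ?_ ?_ ?_ ?_)⟩
  · filter_upwards [hz.eventually_notMem_range s₀] with h hx
    exact continuous_inner_div hz.continuous hbc hx
  · have h0 : ∀ᶠ h in 𝓝[≠] (0 : ℝ), |h| < η :=
      eventually_nhdsWithin_of_eventually_nhds
        ((continuous_abs.tendsto' 0 0 abs_zero).eventually (gt_mem_nhds hη))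
    filter_upwards [h0] with h hh s hs hne
    have hu : 0 < |s - s₀| := abs_pos.2 (sub_ne_zero.2 hne)
    have hp := hest h s hh hs
    refine (abs_inner_div_le _ _).trans ?_
    calc ‖b s‖ / ‖z s₀ + h • normal z s₀ - z s‖
        ≤ (C * |s - s₀| ^ (α : ℝ) + |k| * K * |s - s₀|) / (a * |s - s₀|) := by
          gcongr
          exact hbb s hs
      _ = _ := by
          rw [Real.rpow_sub_one hu.ne']
          field_simp
  · refine ((intervalIntegrable_abs_rpow ?_ s₀ _ _).const_mul _).add intervalIntegrable_const
    have : (0 : ℝ) < α := by exact_mod_cast hα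
    linarith
  · intro s hs hne
    have hp : z s₀ - z s ≠ 0 := fun h =>
      hne (hz.eq_of_abs_sub_le hs (sub_eq_zero.1 h).symm)
    have ht : Tendsto (fun h : ℝ => z s₀ + h • normal z s₀ - z s) (𝓝[≠] 0) (𝓝 (z s₀ - z s)) := by
      refine tendsto_nhdsWithin_of_tendsto_nhds ?_
      exact Continuous.tendsto' (by fun_prop) _ _ (by simp)
    exact (continuousAt_inner_div (b s) hp).tendsto.comp ht

/-- The two-sided limit of the normal derivative of a double-layer potential exists. -/
theorem IsLogProfile.exists_tendsto_normal (hg : IsLogProfile g) (hz : IsClosedCurve z)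
    (hw : ContDiff ℝ 1 w) (hwp : Function.Periodic w (2 * Real.pi)) {α C : ℝ≥0} (hα : 0 < α)
    (hH : HolderWith C α (deriv w)) (s₀ : ℝ) :
    ∃ L, Tendsto (fun h : ℝ => fderiv ℝ (dlp g z w) (z s₀ + h • normal z s₀) (normal z s₀))
      (𝓝[≠] 0) (𝓝 L) := by
  obtain ⟨L, hL⟩ := hz.exists_tendsto_log_part hw hwp hα hH s₀
  obtain ⟨a, η, ha, hη, hest⟩ := hz.exists_normal_estimate s₀
  have hpi := Real.pi_pos
  obtain ⟨Z, hZ⟩ := isCompact_Icc.exists_bound_of_continuousOn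
    (s := Icc (s₀ - Real.pi) (s₀ + Real.pi)) hz.continuous.continuousOn
  obtain ⟨W, hW⟩ := isCompact_Icc.exists_bound_of_continuousOn
    (s := Icc (s₀ - Real.pi) (s₀ + Real.pi)) hw.continuous.continuousOn
  obtain ⟨N, hN⟩ := isCompact_Icc.exists_bound_of_continuousOn
    (s := Icc (s₀ - Real.pi) (s₀ + Real.pi)) (continuous_nvec hz.contDiff_one).continuousOn
  obtain ⟨B, hB, hreg⟩ := hg.exists_reg_bounds (Z + η + Z)
  have hmem : ∀ s, |s - s₀| ≤ Real.pi → s ∈ Icc (s₀ - Real.pi) (s₀ + Real.pi) := fun s hs =>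
    ⟨by linarith [(abs_le.1 hs).1], by linarith [(abs_le.1 hs).2]⟩
  have h0 : ∀ᶠ h in 𝓝[≠] (0 : ℝ), |h| < η :=
    eventually_nhdsWithin_of_eventually_nhds
      ((continuous_abs.tendsto' 0 0 abs_zero).eventually (gt_mem_nhds hη))
  -- The regular part is `O(|s - s₀|^(-1/2))` uniformly in `h`.
  have hreglim : Tendsto (fun h : ℝ => ∫ s in (s₀ - Real.pi)..(s₀ + Real.pi),
      w s * regDipoleDeriv g (nvec z s) (normal z s₀) (z s₀ + h • normal z s₀ - z s)) (𝓝[≠] 0)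
      (𝓝 (∫ s in (s₀ - Real.pi)..(s₀ + Real.pi),
        w s * regDipoleDeriv g (nvec z s) (normal z s₀) (z s₀ - z s))) := by
    refine tendsto_integral_punctured
      (bound := fun s => W * (B * N * a ^ (-(1 / 2) : ℝ)) * |s - s₀| ^ (-(1 / 2) : ℝ))
      s₀ ?_ ?_ ?_ ?_
    · filter_upwards [hz.eventually_notMem_range s₀] with h hx
      exact hw.continuous.mul (continuous_regDipoleDeriv hg hz.contDiff_one hx _)
    · filter_upwards [h0, hz.eventually_notMem_range s₀] with h hh hx s hs hne
      have hu : 0 < |s - s₀| := abs_pos.2 (sub_ne_zero.2 hne)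
      have hp := hest h s hh hs
      have hR : ‖z s₀ + h • normal z s₀ - z s‖ ≤ Z + η + Z := by
        refine (norm_sub_le _ _).trans (add_le_add ((norm_add_le _ _).trans (add_le_add ?_ ?_)) ?_)
        · exact hZ s₀ (hmem s₀ (by simpa using hpi.le))
        · rw [norm_smul, hz.norm_normal, mul_one]
          exact hh.le
        · exact hZ s (hmem s hs)
      have h1 := (hreg _ (sub_mem_compl_zero hx s) hR (nvec z s) (normal z s₀)).2
      rw [hz.norm_normal, mul_one] at h1
      have h2 : ‖z s₀ + h • normal z s₀ - z s‖ ^ (-(1 / 2) : ℝ)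
          ≤ a ^ (-(1 / 2) : ℝ) * |s - s₀| ^ (-(1 / 2) : ℝ) := by
        rw [← Real.mul_rpow ha.le hu.le]
        exact Real.rpow_le_rpow_of_nonpos (by positivity) hp (by norm_num)
      have hW0 : 0 ≤ W := (norm_nonneg _).trans (hW s (hmem s hs))
      have hN0 : 0 ≤ N := (norm_nonneg _).trans (hN s (hmem s hs))
      rw [abs_mul]
      calc |w s| * |regDipoleDeriv g (nvec z s) (normal z s₀) (z s₀ + h • normal z s₀ - z s)|
          ≤ W * (B * N * (a ^ (-(1 / 2) : ℝ) * |s - s₀| ^ (-(1 / 2) : ℝ))) := by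
            gcongr
            · exact hW s (hmem s hs)
            · refine h1.trans ?_
              gcongr
              exact hN s (hmem s hs)
        _ = _ := by ring
    · exact (intervalIntegrable_abs_rpow (by norm_num) s₀ _ _).const_mul _
    · intro s hs hne
      have hp : z s₀ - z s ≠ 0 := fun h =>
        hne (hz.eq_of_abs_sub_le hs (sub_eq_zero.1 h).symm)
      have ht : Tendsto (fun h : ℝ => z s₀ + h • normal z s₀ - z s) (𝓝[≠] 0)
          (𝓝 (z s₀ - z s)) := by
        refine tendsto_nhdsWithin_of_tendsto_nhds ?_
        exact Continuous.tendsto' (by fun_prop) _ _ (by simp)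
      exact ((hg.continuousAt_regDipoleDeriv (nvec z s) (normal z s₀) hp).tendsto.comp
        ht).const_mul _
  refine ⟨_, Tendsto.congr' ?_ (hL.neg.sub hreglim)⟩
  filter_upwards [hz.eventually_notMem_range s₀] with h hx
  rw [hg.fderiv_dlp_eq hz.contDiff_one hz.periodic hw hwp hx, quarterTurn_normal]
  congr 1
  exact (integral_period_eq (fun s => by
    simp only [hz.periodic s, hwp s, periodic_nvec hz.periodic s]) s₀).symm

/-- A double-layer potential extends continuously to the boundary from each connected open set
that does not meet the curve: subtracting the value of the density at the nearest point of the
curve makes the integrand bounded, and the potential of a constant density is constant. -/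
theorem IsLogProfile.exists_tendsto_boundary (hg : IsLogProfile g) (hz : IsClosedCurve z)
    (hw : ContDiff ℝ 1 w) (hwp : Function.Periodic w (2 * Real.pi)) {Ω : Set Plane}
    (hΩ : IsOpen Ω) (hc : IsPreconnected Ω) (hd : Disjoint Ω (range z)) (s₀ : ℝ) :
    ∃ L, Tendsto (dlp g z w) (𝓝[Ω] (z s₀)) (𝓝 L) := by
  obtain ⟨b, hbconst⟩ := dlp_log_one_const hz.contDiff_one hz.periodic hΩ hc hd
  obtain ⟨a, δ, ha, hδ, hest⟩ := hz.exists_chord_arc s₀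
  have hpi := Real.pi_pos
  set I := Icc (s₀ - Real.pi) (s₀ + Real.pi) with hI
  have hmem : ∀ s, |s - s₀| ≤ Real.pi → s ∈ I := fun s hs =>
    ⟨by linarith [(abs_le.1 hs).1], by linarith [(abs_le.1 hs).2]⟩
  have hmem' : ∀ s ∈ I, |s - s₀| ≤ Real.pi := fun s hs =>
    abs_le.2 ⟨by linarith [hs.1], by linarith [hs.2]⟩
  have hs₀ : s₀ ∈ I := hmem s₀ (by simpa using hpi.le)
  obtain ⟨Z, hZ⟩ := isCompact_Icc.exists_bound_of_continuousOn (s := I) hz.continuous.continuousOn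
  obtain ⟨W, hW⟩ := isCompact_Icc.exists_bound_of_continuousOn (s := I) hw.continuous.continuousOn
  obtain ⟨N, hN⟩ := isCompact_Icc.exists_bound_of_continuousOn (s := I)
    (continuous_nvec hz.contDiff_one).continuousOn
  obtain ⟨K, hK, hlip⟩ := exists_lipschitz_bound hw (s₀ - Real.pi) (s₀ + Real.pi)
  obtain ⟨B, hB, hreg⟩ := hg.exists_reg_bounds (Z + 1 + Z)
  have hW0 : 0 ≤ W := (norm_nonneg _).trans (hW s₀ hs₀)
  have hN0 : 0 ≤ N := (norm_nonneg _).trans (hN s₀ hs₀)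
  -- The parameter `t` of the point of the curve nearest to `x`.
  have hmin : ∀ x : Plane, ∃ t ∈ I, ∀ s ∈ I, ‖x - z t‖ ≤ ‖x - z s‖ := fun x =>
    isCompact_Icc.exists_isMinOn ⟨s₀, hs₀⟩
      ((continuous_const.sub hz.continuous).norm).continuousOn
  choose t htI htmin using hmin
  have hnot : ∀ x ∈ Ω, x ∉ range z := fun x hx h => disjoint_left.1 hd hx h
  have hΩmem : ∀ᶠ x in 𝓝[Ω] (z s₀), x ∈ Ω := self_mem_nhdsWithin
  have htlim : Tendsto t (𝓝[Ω] (z s₀)) (𝓝 s₀) := by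
    rw [tendsto_iff_dist_tendsto_zero]
    have hnorm : Tendsto (fun x : Plane => 2 / a * ‖x - z s₀‖) (𝓝[Ω] (z s₀)) (𝓝 0) := by
      refine tendsto_nhdsWithin_of_tendsto_nhds (Continuous.tendsto' (by fun_prop) _ _ (by simp))
    refine squeeze_zero (fun _ => dist_nonneg) (fun x => ?_) hnorm
    have h1 := hest s₀ (t x) (by simpa using hδ) (hmem' _ (htI x))
    have h2 : ‖z (t x) - z s₀‖ ≤ ‖x - z (t x)‖ + ‖x - z s₀‖ := by
      rw [show z (t x) - z s₀ = (x - z s₀) - (x - z (t x)) by abel]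
      linarith [norm_sub_le (x - z s₀) (x - z (t x))]
    have h3 := htmin x s₀ hs₀
    rw [Real.dist_eq, div_mul_eq_mul_div, le_div_iff₀ ha]
    linarith
  have hnear : ∀ᶠ x in 𝓝[Ω] (z s₀), |t x - s₀| < δ := by
    have := htlim.eventually (Metric.ball_mem_nhds s₀ hδ)
    filter_upwards [this] with x hx
    simpa [Real.dist_eq] using hx
  have hxlim : ∀ s, Tendsto (fun x => x - z s) (𝓝[Ω] (z s₀)) (𝓝 (z s₀ - z s)) := fun s =>
    tendsto_nhdsWithin_of_tendsto_nhds (Continuous.tendsto (by fun_prop) _)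
  have hne0 : ∀ s, |s - s₀| ≤ Real.pi → s ≠ s₀ → z s₀ - z s ≠ 0 := fun s hs hne h =>
    hne (hz.eq_of_abs_sub_le hs (sub_eq_zero.1 h).symm)
  have hlim1 : Tendsto (fun x => ∫ s in (s₀ - Real.pi)..(s₀ + Real.pi),
      (w s - w (t x)) * (⟪x - z s, nvec z s⟫ / ‖x - z s‖ ^ 2)) (𝓝[Ω] (z s₀))
      (𝓝 (∫ s in (s₀ - Real.pi)..(s₀ + Real.pi),
        (w s - w s₀) * (⟪z s₀ - z s, nvec z s⟫ / ‖z s₀ - z s‖ ^ 2))) := by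
    refine tendsto_integral_punctured (bound := fun _ => 2 * K / a * N) s₀ ?_ ?_
      intervalIntegrable_const ?_
    · filter_upwards [hΩmem] with x hx
      exact (hw.continuous.sub continuous_const).mul
        (continuous_inner_div hz.continuous (continuous_nvec hz.contDiff_one) (hnot x hx))
    · filter_upwards [hΩmem, hnear] with x hx hxt s hs _
      have hp : 0 < ‖x - z s‖ := norm_pos_iff.2 (sub_mem_compl_zero (hnot x hx) s)
      have h1 := hest (t x) s hxt hs
      have h2 : ‖z s - z (t x)‖ ≤ 2 * ‖x - z s‖ := by
        rw [show z s - z (t x) = (x - z (t x)) - (x - z s) by abel]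
        linarith [norm_sub_le (x - z (t x)) (x - z s), htmin x s (hmem s hs)]
      have h3 : |w s - w (t x)| ≤ 2 * K / a * ‖x - z s‖ := by
        refine (hlip s (hmem s hs) (t x) (htI x)).trans ?_
        have h4 : |s - t x| ≤ 2 * ‖x - z s‖ / a := by
          rw [le_div_iff₀ ha]
          linarith
        calc K * |s - t x| ≤ K * (2 * ‖x - z s‖ / a) := by gcongr
          _ = _ := by ring
      rw [abs_mul]
      calc _ ≤ 2 * K / a * ‖x - z s‖ * (N / ‖x - z s‖) := by
            gcongr
            refine (abs_inner_div_le _ _).trans ?_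
            gcongr
            exact hN s (hmem s hs)
        _ = _ := by field_simp
    · intro s hs hne
      refine Tendsto.mul (tendsto_const_nhds.sub ((hw.continuous.tendsto s₀).comp htlim)) ?_
      exact (continuousAt_inner_div (nvec z s) (hne0 s hs hne)).tendsto.comp (hxlim s)
  have hlim2 : Tendsto (fun x => ∫ s in (s₀ - Real.pi)..(s₀ + Real.pi),
      w s * regDipole g (nvec z s) (x - z s)) (𝓝[Ω] (z s₀))
      (𝓝 (∫ s in (s₀ - Real.pi)..(s₀ + Real.pi),
        w s * regDipole g (nvec z s) (z s₀ - z s))) := by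
    have hball : ∀ᶠ x in 𝓝[Ω] (z s₀), ‖x - z s₀‖ < 1 := by
      filter_upwards [mem_nhdsWithin_of_mem_nhds (Metric.ball_mem_nhds (z s₀) one_pos)] with x hx
      simpa [dist_eq_norm] using hx
    refine tendsto_integral_punctured (bound := fun _ => W * (B * N)) s₀ ?_ ?_
      intervalIntegrable_const ?_
    · filter_upwards [hΩmem] with x hx
      exact hw.continuous.mul (continuous_regDipole hg hz.contDiff_one (hnot x hx))
    · filter_upwards [hΩmem, hball] with x hx hxb s hs _
      have hR : ‖x - z s‖ ≤ Z + 1 + Z := by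
        rw [show x - z s = z s₀ + (x - z s₀) - z s by abel]
        exact (norm_sub_le _ _).trans (add_le_add ((norm_add_le _ _).trans
          (add_le_add (hZ s₀ hs₀) hxb.le)) (hZ s (hmem s hs)))
      have h1 := (hreg _ (sub_mem_compl_zero (hnot x hx) s) hR (nvec z s) 0).1
      rw [abs_mul]
      gcongr
      · exact hW s (hmem s hs)
      · refine h1.trans ?_
        gcongr
        exact hN s (hmem s hs)
    · intro s hs hne
      exact ((hg.continuousAt_regDipole (nvec z s) (hne0 s hs hne)).tendsto.comp
        (hxlim s)).const_mul _
  have hlim3 : Tendsto (fun x => w (t x) * b) (𝓝[Ω] (z s₀)) (𝓝 (w s₀ * b)) :=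
    ((hw.continuous.tendsto s₀).comp htlim).mul_const b
  refine ⟨_, Tendsto.congr' ?_ ((hlim1.add hlim3).sub hlim2)⟩
  filter_upwards [hΩmem] with x hx
  have hx' := hnot x hx
  have hi := continuous_inner_div hz.continuous (continuous_nvec hz.contDiff_one) hx'
  have hr := continuous_regDipole hg hz.contDiff_one hx'
  have hwm : Continuous fun s => w s - w (t x) := hw.continuous.sub continuous_const
  have hper : ∀ s, nvec z (s + 2 * Real.pi) = nvec z s := periodic_nvec hz.periodic
  rw [← hbconst x hx, dlp_log_one_eq hx', ← integral_period_eq (fun s => by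
      simp only [hz.periodic s, hwp s, hper]) s₀, ← integral_period_eq (fun s => by
      simp only [hz.periodic s, hwp s, hper]) s₀, ← intervalIntegral.integral_const_mul,
    ← intervalIntegral.integral_add
      ((hwm.fun_mul hi).intervalIntegrable _ _)
      ((continuous_const.fun_mul hi).intervalIntegrable _ _),
    ← intervalIntegral.integral_sub
      (((hwm.fun_mul hi).fun_add (continuous_const.fun_mul hi)).intervalIntegrable _ _)
      ((hw.continuous.fun_mul hr).intervalIntegrable _ _), dlp, ← intervalIntegral.integral_neg]
  refine intervalIntegral.integral_congr fun s _ => ?_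
  simp only [dipole_eq_reg]
  ring

end boundary

/-! ### The double-layer ansatz on a domain with several boundary curves -/

section domain

variable {κ c : ℝ} {k : ℕ} {Ω : Set Plane} {z : Fin k → ℝ → Plane} {α : ℝ≥0} {q : Plane → ℝ}
  {x : Plane}

theorem IsC3Domain.isClosedCurve (hΩ : IsC3Domain Ω z) (j : Fin k) : IsClosedCurve (z j) where
  contDiff := (hΩ.contDiff j).of_le (by norm_num)
  periodic := hΩ.periodic j
  regular := hΩ.regular j
  injective s hs t ht h := (hΩ.injective j j s hs t ht h).2

theorem IsC3Domain.notMem_range (hΩ : IsC3Domain Ω z) (hx : x ∈ Ω) (j : Fin k) :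
    x ∉ range (z j) := fun h => by
  have hf : x ∈ frontier Ω := by
    rw [hΩ.frontier_eq]
    exact mem_iUnion.2 ⟨j, h⟩
  rw [hΩ.isOpen.frontier_eq] at hf
  exact hf.2 hx

theorem IsC3Domain.notMem_range_of_ne (hΩ : IsC3Domain Ω z) {i j : Fin k} (hij : i ≠ j) (s : ℝ) :
    z j s ∉ range (z i) := by
  rintro ⟨t, ht⟩
  obtain ⟨t', ht', h1⟩ := (hΩ.periodic i).exists_mem_Ico₀ Real.two_pi_pos t
  obtain ⟨s', hs', h2⟩ := (hΩ.periodic j).exists_mem_Ico₀ Real.two_pi_pos s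
  exact hij (hΩ.injective i j t' ht' s' hs' (by rw [← h1, ← h2, ht])).1

theorem IsC3Domain.periodic_comp (hΩ : IsC3Domain Ω z) (q : Plane → ℝ) (j : Fin k) :
    Function.Periodic (fun s => q (z j s)) (2 * Real.pi) := fun s => by
  simp only [hΩ.periodic j s]

theorem fderiv_fundSol_apply (hγ : 0 < gam κ c) (n : ℕ) {y : Plane} (hxy : x - y ≠ 0)
    (v : Plane) :
    fderiv ℝ (fun y => fundSol κ c n x y) y v = -dipole (profile κ c n) v (x - y) := by
  have hpos : 0 < ‖x - y‖ ^ 2 := by positivity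
  have he : (fun y => fundSol κ c n x y) =ᶠ[𝓝 y] fun y => profile κ c n (‖x - y‖ ^ 2) := by
    have hopen : IsOpen {y : Plane | x - y ≠ 0} :=
      isOpen_compl_singleton.preimage (continuous_const.sub continuous_id)
    filter_upwards [hopen.mem_nhds hxy] with y' hy'
    exact fundProfile_eq hγ n (norm_pos_iff.2 hy')
  have h := (hasFDerivAt_comp_norm_sq ((isLogProfile_profile κ c n).hasDerivAt hpos)).comp y
    ((hasFDerivAt_id y).const_sub x)
  rw [he.fderiv_eq]
  have h' : HasFDerivAt (fun y => profile κ c n (‖x - y‖ ^ 2)) _ y := h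
  rw [h'.fderiv, dipole]
  simp [inner_sub_left]
  ring

theorem doubleLayerIntegral_eq (hγ : 0 < gam κ c) (hΩ : IsC3Domain Ω z) (n : ℕ) (q : Plane → ℝ)
    (hx : ∀ j, x ∉ range (z j)) :
    doubleLayerIntegral κ c z n q x
      = ∑ j, dlp (profile κ c n) (z j) (fun s => q (z j s)) x := by
  rw [doubleLayerIntegral, boundaryIntegral]
  refine Finset.sum_congr rfl fun j _ => ?_
  rw [dlp, ← intervalIntegral.integral_neg]
  refine intervalIntegral.integral_congr fun s _ => ?_
  have hd : ‖deriv (z j) s‖ ≠ 0 := norm_ne_zero_iff.2 (hΩ.regular j s)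
  simp only [fderiv_fundSol_apply hγ n (sub_mem_compl_zero (hx j) s), normal_eq, dipole,
    inner_smul_right]
  field_simp

theorem IsC3Domain.isOpen_compl (hΩ : IsC3Domain Ω z) : IsOpen {x | ∀ j, x ∉ range (z j)} := by
  simp only [ofPred_forall]
  exact isOpen_iInter_of_finite fun j =>
    (isClosed_range_of_periodic (hΩ.contDiff j).continuous (hΩ.periodic j)).isOpen_compl

theorem contDiffOn_doubleLayerIntegral (hγ : 0 < gam κ c) (hΩ : IsC3Domain Ω z)
    (hq : IsC1Holder α z q) (n m : ℕ) :
    ContDiffOn ℝ m (doubleLayerIntegral κ c z n q) {x | ∀ j, x ∉ range (z j)} :=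
  ContDiffOn.congr (ContDiffOn.sum fun j _ =>
    ((isLogProfile_profile κ c n).contDiffOn_dlp (hΩ.isClosedCurve j).contDiff_one (hΩ.periodic j)
      (hq j).1.continuous m).mono fun _ hx => hx j)
    fun _ hx => doubleLayerIntegral_eq hγ hΩ n q hx

theorem laplacian_doubleLayerIntegral (hγ : 0 < gam κ c) (hΩ : IsC3Domain Ω z)
    (hq : IsC1Holder α z q) (n : ℕ) (hx : ∀ j, x ∉ range (z j)) :
    Laplacian.laplacian (doubleLayerIntegral κ c z n q) x
      = gam κ c ^ 2 * doubleLayerIntegral κ c z n q x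
        + ∑ m ∈ Finset.range n, beta κ c (n - m) * doubleLayerIntegral κ c z m q x := by
  have he : doubleLayerIntegral κ c z n q
      =ᶠ[𝓝 x] fun x => ∑ j, dlp (profile κ c n) (z j) (fun s => q (z j s)) x := by
    filter_upwards [hΩ.isOpen_compl.mem_nhds hx] with y hy
    exact doubleLayerIntegral_eq hγ hΩ n q hy
  have hsm : ∀ j, ContDiffAt ℝ 2 (dlp (profile κ c n) (z j) (fun s => q (z j s))) x := fun j =>
    ((isLogProfile_profile κ c n).contDiffOn_dlp (hΩ.isClosedCurve j).contDiff_one (hΩ.periodic j)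
      (hq j).1.continuous 2).contDiffAt ((isClosed_range_of_periodic (hΩ.contDiff j).continuous
        (hΩ.periodic j)).isOpen_compl.mem_nhds (hx j))
  have hadd : ∀ t : Finset (Fin k), Laplacian.laplacian
      (fun x => ∑ j ∈ t, dlp (profile κ c n) (z j) (fun s => q (z j s)) x) x
      = ∑ j ∈ t, Laplacian.laplacian (dlp (profile κ c n) (z j) (fun s => q (z j s))) x := by
    classical
    intro t
    induction t using Finset.induction_on with
    | empty =>
      simp only [Finset.sum_empty]
      simp
    | insert j t hj ih =>
      simp only [Finset.sum_insert hj]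
      rw [← ih]
      exact (hsm j).laplacian_add (ContDiffAt.sum fun i _ => hsm i)
  rw [(InnerProductSpace.laplacian_congr_nhds he).eq_of_nhds, hadd]
  simp only [fun m => doubleLayerIntegral_eq hγ hΩ m q hx, Finset.mul_sum]
  rw [Finset.sum_comm, ← Finset.sum_add_distrib]
  refine Finset.sum_congr rfl fun j _ => ?_
  exact laplacian_dlp_profile hγ (hΩ.isClosedCurve j).contDiff_one (hΩ.periodic j)
    (hq j).1.continuous (hx j) n

/-- Every double-layer potential has a limit from inside the domain at every point of the
plane. -/
theorem exists_tendsto_doubleLayerIntegral (hγ : 0 < gam κ c) (hΩ : IsC3Domain Ω z)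
    (hq : IsC1Holder α z q) (n : ℕ) (x : Plane) :
    ∃ L, Tendsto (doubleLayerIntegral κ c z n q) (𝓝[Ω] x) (𝓝 L) := by
  have hg := isLogProfile_profile κ c n
  have hex : ∀ j, ∃ L, Tendsto (dlp (profile κ c n) (z j) (fun s => q (z j s)))
      (𝓝[Ω] x) (𝓝 L) := fun j => by
    by_cases hx : x ∈ range (z j)
    · obtain ⟨s, rfl⟩ := hx
      exact hg.exists_tendsto_boundary (hΩ.isClosedCurve j) (hq j).1
        (hΩ.periodic_comp q j) hΩ.isOpen hΩ.isConnected.isPreconnected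
        (disjoint_left.2 fun y hy => hΩ.notMem_range hy j) s
    · have := ((hg.contDiffOn_dlp (hΩ.isClosedCurve j).contDiff_one (hΩ.periodic j)
        (hq j).1.continuous 0).continuousOn.continuousAt
        ((isClosed_range_of_periodic (hΩ.contDiff j).continuous
          (hΩ.periodic j)).isOpen_compl.mem_nhds hx)).tendsto
      exact ⟨_, tendsto_nhdsWithin_of_tendsto_nhds this⟩
  choose L hL using hex
  refine ⟨∑ j, L j, Tendsto.congr' ?_ (tendsto_finsetSum _ fun j _ => hL j)⟩
  filter_upwards [self_mem_nhdsWithin] with y hy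
  exact (doubleLayerIntegral_eq hγ hΩ n q (hΩ.notMem_range hy)).symm

theorem eventually_notMem_all (hΩ : IsC3Domain Ω z) (j : Fin k) (s : ℝ) :
    ∀ᶠ h in 𝓝[≠] (0 : ℝ), ∀ i, z j s + h • normal (z j) s ∉ range (z i) := by
  refine eventually_all.2 fun i => ?_
  by_cases hij : i = j
  · subst hij
    exact (hΩ.isClosedCurve i).eventually_notMem_range s
  · have hopen := (isClosed_range_of_periodic (hΩ.contDiff i).continuous
      (hΩ.periodic i)).isOpen_compl
    have ht : Tendsto (fun h : ℝ => z j s + h • normal (z j) s) (𝓝[≠] 0) (𝓝 (z j s)) :=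
      tendsto_nhdsWithin_of_tendsto_nhds (Continuous.tendsto' (by fun_prop) _ _ (by simp))
    exact ht.eventually (hopen.mem_nhds (hΩ.notMem_range_of_ne hij s))

/-- The limit defining `opT` exists, so that `normalDerivative` is not a junk value. -/
theorem tendsto_normalDerivative (hγ : 0 < gam κ c) (hΩ : IsC3Domain Ω z) (hα : 0 < α)
    (hq : IsC1Holder α z q) (n : ℕ) (j : Fin k) (s : ℝ) :
    Tendsto (fun h : ℝ => fderiv ℝ (doubleLayerIntegral κ c z n q)
        (z j s + h • normal (z j) s) (normal (z j) s)) (𝓝[≠] 0)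
      (𝓝 (normalDerivative z (doubleLayerIntegral κ c z n q) j s)) := by
  have hg := isLogProfile_profile κ c n
  have hex : ∀ i, ∃ L, Tendsto (fun h : ℝ =>
      fderiv ℝ (dlp (profile κ c n) (z i) (fun s => q (z i s))) (z j s + h • normal (z j) s)
        (normal (z j) s)) (𝓝[≠] 0) (𝓝 L) := fun i => by
    by_cases hij : i = j
    · subst hij
      obtain ⟨C, hC⟩ := (hq i).2
      exact hg.exists_tendsto_normal (hΩ.isClosedCurve i) (hq i).1
        (hΩ.periodic_comp q i) hα hC s
    · have hopen := (isClosed_range_of_periodic (hΩ.contDiff i).continuous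
        (hΩ.periodic i)).isOpen_compl
      have hcont := ((hg.contDiffOn_dlp (hΩ.isClosedCurve i).contDiff_one (hΩ.periodic i)
        (hq i).1.continuous 1).continuousOn_fderiv_of_isOpen hopen (by norm_num)).continuousAt
        (hopen.mem_nhds (hΩ.notMem_range_of_ne hij s))
      have ht : Tendsto (fun h : ℝ => z j s + h • normal (z j) s) (𝓝[≠] 0) (𝓝 (z j s)) :=
        tendsto_nhdsWithin_of_tendsto_nhds (Continuous.tendsto' (by fun_prop) _ _ (by simp))
      exact ⟨_, (hcont.clm_apply continuousAt_const).tendsto.comp ht⟩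
  choose L hL using hex
  refine tendsto_nhds_limUnder ⟨∑ i, L i, Tendsto.congr' ?_ (tendsto_finsetSum _ fun i _ => hL i)⟩
  filter_upwards [eventually_notMem_all hΩ j s] with h hx
  have he : doubleLayerIntegral κ c z n q =ᶠ[𝓝 (z j s + h • normal (z j) s)]
      fun x => ∑ j, dlp (profile κ c n) (z j) (fun s => q (z j s)) x := by
    filter_upwards [hΩ.isOpen_compl.mem_nhds hx] with y hy
    exact doubleLayerIntegral_eq hγ hΩ n q hy
  rw [he.fderiv_eq, fderiv_fun_sum fun i _ => ?_]
  · simp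
  · exact ((hg.contDiffOn_dlp (hΩ.isClosedCurve i).contDiff_one (hΩ.periodic i)
      (hq i).1.continuous 1).contDiffAt ((isClosed_range_of_periodic (hΩ.contDiff i).continuous
        (hΩ.periodic i)).isOpen_compl.mem_nhds (hx i))).differentiableAt (by norm_num)

end domain

/-- The convolution structure of the right-hand sides. -/
theorem sum_convolution (b : ℕ → ℝ) (D : ℕ → ℕ → ℝ) (n : ℕ) :
    ∑ m ∈ Finset.range (n + 1), ∑ l ∈ Finset.range (n - m), b (n - m - l) * D l m
      = ∑ m' ∈ Finset.range n, b (n - m') * ∑ m ∈ Finset.range (m' + 1), D (m' - m) m := by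
  have h : ∀ m ∈ Finset.range (n + 1), ∑ l ∈ Finset.range (n - m), b (n - m - l) * D l m
      = ∑ m' ∈ Finset.Ico m n, b (n - m') * D (m' - m) m := fun m _ => by
    rw [Finset.sum_Ico_eq_sum_range]
    refine Finset.sum_congr rfl fun l _ => ?_
    rw [Nat.sub_sub, Nat.add_sub_cancel_left]
  rw [Finset.sum_congr rfl h]
  simp only [Finset.mul_sum]
  refine Finset.sum_comm' fun m m' => ?_
  simp only [Finset.mem_range, Finset.mem_Ico]
  omega

end LaguerreNeumann

end

open LaguerreNeumann in
theorem mainTheorem2 (κ c : ℝ) (hκ : 0 < κ) (hc : 0 < c)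
    {k : ℕ} (Ω : Set LaguerreNeumann.Plane) (z : Fin k → ℝ → LaguerreNeumann.Plane)
    (hΩ : LaguerreNeumann.IsC3Domain Ω z)
    (α : ℝ≥0) (hα : 0 < α) (hα1 : α < 1)
    (f q : ℕ → LaguerreNeumann.Plane → ℝ)
    (hq : ∀ n, LaguerreNeumann.IsC1Holder α z (q n))
    (heq : ∀ n j s,
      LaguerreNeumann.opT κ c z 0 (q n) j s
        = f n (z j s)
          - ∑ m ∈ Finset.range n, LaguerreNeumann.opT κ c z (n - m) (q m) j s) :
    LaguerreNeumann.SolvesNeumann κ c Ω z f (LaguerreNeumann.doubleLayerAnsatz κ c z q) := by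
  have hγ := gam_pos hκ hc
  have hsub : Ω ⊆ {x | ∀ j, x ∉ range (z j)} := fun x hx => hΩ.notMem_range hx
  have hsm : ∀ n, ContDiffOn ℝ 2 (doubleLayerAnsatz κ c z q n) {x | ∀ j, x ∉ range (z j)} :=
    fun n => contDiffOn_const.mul
      (ContDiffOn.sum fun m _ => contDiffOn_doubleLayerIntegral hγ hΩ (hq m) (n - m) 2)
  refine ⟨fun n => (hsm n).mono hsub, fun n => ?_, fun n x hx => ?_, fun n j s => ?_⟩
  · have hlim : ∀ x ∈ closure Ω, ∃ L, Tendsto (doubleLayerAnsatz κ c z q n) (𝓝[Ω] x) (𝓝 L) := by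
      intro x _
      choose L hL using fun m => exists_tendsto_doubleLayerIntegral hγ hΩ (hq m) (n - m) x
      exact ⟨_, (tendsto_finsetSum _ fun m _ => hL m).const_mul _⟩
    refine ⟨extendFrom Ω (doubleLayerAnsatz κ c z q n), continuousOn_extendFrom le_rfl hlim,
      fun x hx => extendFrom_eq (subset_closure hx) ?_⟩
    exact ((hsm n).mono hsub).continuousOn x hx
  · have hsm' : ∀ m, ContDiffAt ℝ 2 (doubleLayerIntegral κ c z (n - m) (q m)) x := fun m =>
      (contDiffOn_doubleLayerIntegral hγ hΩ (hq m) (n - m) 2).contDiffAt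
        (hΩ.isOpen_compl.mem_nhds (hsub hx))
    have hadd : ∀ N : ℕ, Laplacian.laplacian
        (fun x => ∑ m ∈ Finset.range N, doubleLayerIntegral κ c z (n - m) (q m) x) x
        = ∑ m ∈ Finset.range N,
          Laplacian.laplacian (doubleLayerIntegral κ c z (n - m) (q m)) x := by
      intro N
      induction N with
      | zero => simp
      | succ N ih =>
        simp only [Finset.sum_range_succ]
        rw [← ih]
        exact (ContDiffAt.sum fun m _ => hsm' m).laplacian_add (hsm' N)
    have hΔ : Laplacian.laplacian (doubleLayerAnsatz κ c z q n) x = 1 / Real.pi *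
        ∑ m ∈ Finset.range (n + 1),
          Laplacian.laplacian (doubleLayerIntegral κ c z (n - m) (q m)) x := by
      rw [← hadd]
      exact InnerProductSpace.laplacian_smul (1 / Real.pi) (ContDiffAt.sum fun m _ => hsm' m)
    rw [hΔ, Finset.sum_congr rfl fun m _ =>
      laplacian_doubleLayerIntegral hγ hΩ (hq m) (n - m) (hsub hx), Finset.sum_add_distrib,
      sum_convolution (beta κ c) fun l m => doubleLayerIntegral κ c z l (q m) x]
    simp only [doubleLayerAnsatz, ← Finset.mul_sum, mul_left_comm _ (1 / Real.pi)]
    ring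
  · have hlim : Tendsto (fun h : ℝ => 1 / Real.pi * ∑ m ∈ Finset.range (n + 1),
        fderiv ℝ (doubleLayerIntegral κ c z (n - m) (q m)) (z j s + h • normal (z j) s)
          (normal (z j) s)) (𝓝[≠] 0) (𝓝 (f n (z j s))) := by
      have hval : f n (z j s) = 1 / Real.pi * ∑ m ∈ Finset.range (n + 1),
          normalDerivative z (doubleLayerIntegral κ c z (n - m) (q m)) j s := by
        have := heq n j s
        rw [Finset.sum_range_succ, Nat.sub_self, mul_add, Finset.mul_sum]
        simp only [opT] at this
        linarith
      rw [hval]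
      exact (tendsto_finsetSum _ fun m _ =>
        tendsto_normalDerivative hγ hΩ hα (hq m) (n - m) j s).const_mul _
    have hlim' : Tendsto (fun h : ℝ => fderiv ℝ (doubleLayerAnsatz κ c z q n)
        (z j s + h • normal (z j) s) (normal (z j) s)) (𝓝[≠] 0) (𝓝 (f n (z j s))) := by
      refine hlim.congr' ?_
      filter_upwards [eventually_notMem_all hΩ j s] with h hx
      have hd : ∀ m, DifferentiableAt ℝ (doubleLayerIntegral κ c z (n - m) (q m))
          (z j s + h • normal (z j) s) := fun m =>
        ((contDiffOn_doubleLayerIntegral hγ hΩ (hq m) (n - m) 1).contDiffAt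
          (hΩ.isOpen_compl.mem_nhds hx)).differentiableAt (by norm_num)
      have hfd := (HasFDerivAt.fun_sum (u := Finset.range (n + 1))
        fun m _ => (hd m).hasFDerivAt).const_mul (1 / Real.pi)
      have hfd' : HasFDerivAt (doubleLayerAnsatz κ c z q n) _ _ := hfd
      rw [hfd'.fderiv]
      simp
    have hneg : Tendsto (fun h : ℝ => -h) (𝓝[>] 0) (𝓝[≠] 0) := by
      refine tendsto_nhdsWithin_iff.2 ⟨tendsto_nhdsWithin_of_tendsto_nhds
        (continuous_neg.tendsto' 0 0 neg_zero), ?_⟩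
      filter_upwards [self_mem_nhdsWithin] with h hh
      exact neg_ne_zero.2 (ne_of_gt hh)
    refine (hlim'.comp hneg).congr fun h => ?_
    simp only [Function.comp_apply, neg_smul, sub_eq_add_neg]
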